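/- Let $K$ be an algebraically closed field of characteristic zero and let $\ell\neq 0$ be a finite-dimensional semisimple Lie algebra over $K$, with dual $\ell'$, a basis $\{u\}$ and the dual basis $\{u'\}$ of $\ell'$. Consider the operators $\beta_n^x,\gamma_n^f,b_n^x,c_n^f$ ($n\in\mathbb Z$, $x\in\ell$, $f\in\ell'$, linear in $x$ and $f$), where $\beta,\gamma$ are even and $b,c$ are odd, with supercommutators $$[\gamma_n^{f},\beta_m^{x}]=\langle f,x\rangle\,\delta_{n+m,0},\qquad [c_n^{f},b_m^{x}]=\langle f,x\rangle\,\delta_{n+m,0},$$ all other supercommutators being zero. Call $\beta_n^x,b_n^x$ with $n\le -1$ and $\gamma_n^f,c_n^f$ with $n\le 0$ creation operators and the others annihilation operators. Let $W=W^{\infty/2}\tilde\ell=S^{\infty/2}\tilde\ell'\otimes\wedge^{\infty/2}\tilde\ell'$ be the Fock module generated by a vacuum $\mathbf 1$ killed by all annihilation operators, i.e. the symmetric algebra on the creation operators $\beta,\gamma$ tensored with the exterior algebra on the creation operators $b,c$ (the semi-infinite Weil complex of the loop algebra $\tilde\ell=\ell\otimes K[t,t^{-1}]$). With $:\ :$ denoting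 normal ordering (annihilation operators are moved to the right, with the sign of the permutation of the odd factors), let $x\otimes t^n\in\tilde\ell$ act on $W$ by $$\theta(x_n)=\sum_{v,m}:\beta_{n+m}^{[x,v]}\gamma_{-m}^{v'}:+\sum_{v,m}:b_{n+m}^{[x,v]}c_{-m}^{v'}:$$ and let $$Q=\sum_{u,v;\,i,j}:\beta_{i+j}^{[u,v]}\gamma_{-i}^{v'}c_{-j}^{u'}:+\tfrac12\sum_{u,v;\,i,j}:b_{i+j}^{[u,v]}c_{-i}^{v'}c_{-j}^{u'}:$$ be the semi-infinite cohomology differential ($u,v$ run over the basis, $i,j,m$ over $\mathbb Z$). Let $\phi:\ell\to\ell'$ be the Killing isomorphism, $\phi(x)(y)=\operatorname{tr}(\operatorname{ad}x\,\operatorname{ad}y)$. Then the states $$\mathbf r=\sum_u\gamma_0^{\phi(u)}c_{-1}^{u'}\mathbf 1,\qquad \mathbf t=\sum_u\beta_{-1}^{\phi^{-1}(u')}b_{-1}^{u}\mathbf 1$$ are both invariant under $\ell=\ell\otimes t^0$, that is, killed by $\theta(x_0)$ for all $x\in\ell$, and they represent nontrivial $Q$-cohomology classes: $Q\mathbf r=Q\mathbf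 t=0$, and neither $\mathbf r$ nor $\mathbf t$ lies in the image of $Q$. -/

import Mathlib

open scoped TensorProduct

noncomputable section

namespace VOWA

open Module

/-! ### Derivations of a symmetric algebra -/

section SymDeriv

variable {K : Type*} [Field K] {V : Type*} [AddCommGroup V] [Module K V]

/-- The algebra map `p ↦ p + ε ∂_d p` into the dual numbers over `S V`. -/
def symDerivAux (d : Dual K V) :
    SymmetricAlgebra K V →ₐ[K] TrivSqZeroExt (SymmetricAlgebra K V) (SymmetricAlgebra K V) :=
  SymmetricAlgebra.lift
    ((TrivSqZeroExt.inlAlgHom K (SymmetricAlgebra K V) (SymmetricAlgebra K V)).toLinearMap ∘ₗ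
        SymmetricAlgebra.ι K V +
      (TrivSqZeroExt.inrHom (SymmetricAlgebra K V) (SymmetricAlgebra K V)).restrictScalars K ∘ₗ
        Algebra.linearMap K (SymmetricAlgebra K V) ∘ₗ d)

/-- The derivation `∂_d` of the symmetric algebra `S V` with `∂_d v = d v` for `v ∈ V`. -/
def symDeriv (d : Dual K V) : SymmetricAlgebra K V →ₗ[K] SymmetricAlgebra K V :=
  (TrivSqZeroExt.sndHom (SymmetricAlgebra K V) (SymmetricAlgebra K V)).restrictScalars K ∘ₗ
    (symDerivAux d).toLinearMap

theorem symDerivAux_fst (d : Dual K V) (p : SymmetricAlgebra K V) :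
    (symDerivAux d p).fst = p := by
  have h : (TrivSqZeroExt.fstHom K (SymmetricAlgebra K V) (SymmetricAlgebra K V)).comp
      (symDerivAux d) = AlgHom.id K _ := by
    apply SymmetricAlgebra.algHom_ext
    ext v
    simp [symDerivAux]
  exact DFunLike.congr_fun h p

theorem symDeriv_algebraMap (d : Dual K V) (a : K) :
    symDeriv d (algebraMap K _ a) = 0 := by
  change (symDerivAux d (algebraMap K _ a)).snd = 0
  rw [AlgHom.commutes]
  rfl

theorem symDeriv_ι (d : Dual K V) (v : V) :
    symDeriv d (SymmetricAlgebra.ι K V v) = algebraMap K _ (d v) := by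
  change (symDerivAux d (SymmetricAlgebra.ι K V v)).snd = _
  simp [symDerivAux, Algebra.algebraMap_eq_smul_one]

theorem symDeriv_mul (d : Dual K V) (p q : SymmetricAlgebra K V) :
    symDeriv d (p * q) = p * symDeriv d q + q * symDeriv d p := by
  change (symDerivAux d (p * q)).snd = p * (symDerivAux d q).snd + q * (symDerivAux d p).snd
  rw [map_mul, TrivSqZeroExt.snd_mul, symDerivAux_fst, symDerivAux_fst]
  simp [mul_comm]

theorem symDeriv_comm (d d' : Dual K V) (p : SymmetricAlgebra K V) :
    symDeriv d (symDeriv d' p) = symDeriv d' (symDeriv d p) := by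
  induction p using SymmetricAlgebra.induction with
  | algebraMap r => simp [symDeriv_algebraMap]
  | ι x => simp [symDeriv_ι, symDeriv_algebraMap]
  | mul a b ha hb => simp only [symDeriv_mul, map_add, ha, hb]; ring
  | add a b ha hb => simp only [map_add, ha, hb]

/-- The contraction `ι_d` of the exterior algebra `Λ V`: the odd derivation with `ι_d v = d v` for
`v ∈ V`. -/
def extContract (d : Dual K V) : ExteriorAlgebra K V →ₗ[K] ExteriorAlgebra K V :=
  CliffordAlgebra.contractLeft d

theorem extContract_algebraMap (d : Dual K V) (a : K) :
    extContract d (algebraMap K _ a) = 0 :=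
  CliffordAlgebra.contractLeft_algebraMap _ d a

theorem extContract_ι_mul (d : Dual K V) (v : V) (q : ExteriorAlgebra K V) :
    extContract d (ExteriorAlgebra.ι K v * q) =
      d v • q - ExteriorAlgebra.ι K v * extContract d q :=
  CliffordAlgebra.contractLeft_ι_mul _ _ _

theorem extContract_comm (d d' : Dual K V) (q : ExteriorAlgebra K V) :
    extContract d (extContract d' q) = -extContract d' (extContract d q) :=
  CliffordAlgebra.contractLeft_comm _ _ _

end SymDeriv

/-! ### Cohomology of an operator -/

section Cohomology

variable {K : Type*} [Field K] {M : Type*} [AddCommGroup M] [Module K M]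

/-- The cohomology of an operator: kernel modulo image. -/
abbrev Cohomology (D : End K M) : Type _ :=
  LinearMap.ker D ⧸ (LinearMap.range D).submoduleOf (LinearMap.ker D)

/-- The state `w` is a cocycle for `D` with nonzero cohomology class. -/
def RepresentsNontrivialClass (D : End K M) (w : M) : Prop :=
  ∃ h : w ∈ LinearMap.ker D, (Submodule.Quotient.mk ⟨w, h⟩ : Cohomology D) ≠ 0

end Cohomology

/-! ### The modes and the Fock module -/

section Fock

variable (K : Type*) [Field K] (ℓ : Type*) [LieRing ℓ] [LieAlgebra K ℓ]

/-- The generators `β_n^u, γ_n^f, b_n^u, c_n^f` (`u ∈ ℓ`, `f ∈ ℓ'`, `n ∈ ℤ`) of the Weyl algebra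
and of the Clifford algebra on `ℓ ⊗ K[t, t⁻¹]` and its restricted dual. -/
inductive Mode where
  | beta (n : ℤ) (u : ℓ)
  | gamma (n : ℤ) (f : Dual K ℓ)
  | b (n : ℤ) (u : ℓ)
  | c (n : ℤ) (f : Dual K ℓ)

/-- The span of the creation operators of one statistics: the first component lists the modes
`β_{-1}^u, β_{-2}^u, …` (resp. `b_{-1}^u, b_{-2}^u, …`), the second one the modes
`γ_0^f, γ_{-1}^f, …` (resp. `c_0^f, c_{-1}^f, …`). -/
def Cre : Type _ := (ℕ →₀ ℓ) × (ℕ →₀ Dual K ℓ)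

instance : AddCommGroup (Cre K ℓ) := inferInstanceAs (AddCommGroup ((ℕ →₀ ℓ) × (ℕ →₀ Dual K ℓ)))

instance : Module K (Cre K ℓ) := inferInstanceAs (Module K ((ℕ →₀ ℓ) × (ℕ →₀ Dual K ℓ)))

/-- The semi-infinite symmetric module: polynomials in the creation operators `β`, `γ`. -/
abbrev SInf : Type _ := SymmetricAlgebra K (Cre K ℓ)

/-- The semi-infinite exterior module: Grassmann polynomials in the creation operators `b`, `c`. -/
abbrev ExtInf : Type _ := ExteriorAlgebra K (Cre K ℓ)

/-- The semi-infinite Weil complex of the loop algebra of `ℓ`. -/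
abbrev W : Type _ := SInf K ℓ ⊗[K] ExtInf K ℓ

/-- The vacuum vector. -/
def vac : W K ℓ := 1 ⊗ₜ[K] 1

variable {K ℓ}

/-- The index `n` of a mode. -/
def Mode.idx : Mode K ℓ → ℤ
  | .beta n _ => n
  | .gamma n _ => n
  | .b n _ => n
  | .c n _ => n

/-- Creation operators: `β_n, b_n` with `n ≤ -1` and `γ_n, c_n` with `n ≤ 0`. -/
def Mode.isCre : Mode K ℓ → Bool
  | .beta n _ => decide (n ≤ -1)
  | .gamma n _ => decide (n ≤ 0)
  | .b n _ => decide (n ≤ -1)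
  | .c n _ => decide (n ≤ 0)

/-- The odd generators are the `b`'s and the `c`'s. -/
def Mode.isOdd : Mode K ℓ → Bool
  | .beta _ _ => false
  | .gamma _ _ => false
  | .b _ _ => true
  | .c _ _ => true

/-- The vector of `Cre` which a creation operator stands for. -/
def Mode.creVec : Mode K ℓ → Cre K ℓ
  | .beta n u => (Finsupp.single (-n - 1).toNat u, 0)
  | .gamma n f => (0, Finsupp.single (-n).toNat f)
  | .b n u => (Finsupp.single (-n - 1).toNat u, 0)
  | .c n f => (0, Finsupp.single (-n).toNat f)

/-- The functional `(x, y) ↦ f (x k)` on `Cre`. -/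
def evalFst (k : ℕ) (f : Dual K ℓ) : Dual K (Cre K ℓ) :=
  f ∘ₗ Finsupp.lapply k ∘ₗ LinearMap.fst K (ℕ →₀ ℓ) (ℕ →₀ Dual K ℓ)

/-- The functional `(x, y) ↦ (y k) u` on `Cre`. -/
def evalSnd (k : ℕ) (u : ℓ) : Dual K (Cre K ℓ) :=
  Dual.eval K ℓ u ∘ₗ Finsupp.lapply k ∘ₗ LinearMap.snd K (ℕ →₀ ℓ) (ℕ →₀ Dual K ℓ)

/-- The supercommutators of an annihilation operator with the creation operators, as prescribed by
`[γ_n^f, β_m^u] = f(u) δ_{n+m,0}` and `[c_n^f, b_m^u]_+ = f(u) δ_{n+m,0}`. -/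
def Mode.annFun : Mode K ℓ → Dual K (Cre K ℓ)
  | .beta n u => -evalSnd n.toNat u
  | .gamma n f => evalFst (n - 1).toNat f
  | .b n u => evalSnd n.toNat u
  | .c n f => evalFst (n - 1).toNat f

/-- The action of a mode on the Fock module: a creation operator acts by multiplication, an
annihilation operator by the (super)derivation that extends its supercommutators with the
creation operators; the annihilation operators kill the vacuum. -/
def Mode.op (m : Mode K ℓ) : End K (W K ℓ) :=
  match m.isOdd, m.isCre with
  | false, true => LinearMap.rTensor _ (LinearMap.mulLeft K (SymmetricAlgebra.ι K _ m.creVec))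
  | false, false => LinearMap.rTensor _ (symDeriv m.annFun)
  | true, true => LinearMap.lTensor _ (LinearMap.mulLeft K (ExteriorAlgebra.ι K m.creVec))
  | true, false => LinearMap.lTensor _ (extContract m.annFun)

/-- The parity of a product of modes. -/
def isOddList : List (Mode K ℓ) → Bool
  | [] => false
  | m :: l => xor m.isOdd (isOddList l)

/-- The normally ordered product of a list of modes: annihilation operators are moved to the
right, with a sign for each exchange of odd factors. -/
def normalOrder : List (Mode K ℓ) → End K (W K ℓ)
  | [] => 1
  | m :: l =>
    if m.isCre then m.op * normalOrder l
    else if m.isOdd && isOddList l then -(normalOrder l * m.op)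
    else normalOrder l * m.op

/-! ### Locally finite sums of operators -/

/-- A family of operators is locally finite if only finitely many members act nontrivially on any
given vector. -/
def LocFin {I : Type*} (T : I → End K (W K ℓ)) : Prop :=
  ∀ w, (Function.support fun i => T i w).Finite

/-- The sum of a locally finite family of operators. -/
def opSum {I : Type*} (T : I → End K (W K ℓ)) (hT : LocFin T) : End K (W K ℓ) where
  toFun w := ∑ᶠ i, T i w
  map_add' v w := by
    simp only [map_add]
    exact finsum_add_distrib (hT v) (hT w)
  map_smul' a w := by
    simp only [map_smul, RingHom.id_apply]
    exact (smul_finsum' a (hT w)).symm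

theorem LocFin.add {I : Type*} {T T' : I → End K (W K ℓ)} (h : LocFin T) (h' : LocFin T') :
    LocFin (fun i => T i + T' i) := fun w =>
  ((h w).union (h' w)).subset (Function.support_add _ _)

theorem LocFin.smul {I : Type*} {T : I → End K (W K ℓ)} (a : K) (h : LocFin T) :
    LocFin (fun i => a • T i) := fun w =>
  (h w).subset (Function.support_const_smul_subset a _)

theorem LocFin.sum {I J : Type*} (s : Finset J) {T : J → I → End K (W K ℓ)}
    (h : ∀ j, LocFin (T j)) : LocFin (fun i => ∑ j ∈ s, T j i) := fun w => by
  refine ((s.finite_toSet.biUnion fun j _ => h j w)).subset ?_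
  intro i hi
  by_contra hc
  simp only [Finset.mem_coe, Set.mem_iUnion, Function.mem_support, not_exists, not_not] at hc
  apply hi
  change (∑ j ∈ s, T j i) w = 0
  rw [LinearMap.sum_apply]
  exact Finset.sum_eq_zero fun j hj => hc j hj

/-- `w` is killed by all annihilation operators of index at least `N`. -/
def KilledFrom (N : ℤ) (w : W K ℓ) : Prop :=
  ∀ m : Mode K ℓ, N ≤ m.idx → m.isCre = false → m.op w = 0

theorem annFun_eventually (v : Cre K ℓ) :
    ∃ N : ℤ, ∀ m : Mode K ℓ, N ≤ m.idx → m.annFun v = 0 := by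
  obtain ⟨A, hA⟩ := v.1.support.exists_nat_subset_range
  obtain ⟨B, hB⟩ := v.2.support.exists_nat_subset_range
  have h1 : ∀ k : ℕ, A ≤ k → v.1 k = 0 := fun k hk => by
    by_contra h
    have := Finset.mem_range.1 (hA (Finsupp.mem_support_iff.2 h))
    omega
  have h2 : ∀ k : ℕ, B ≤ k → v.2 k = 0 := fun k hk => by
    by_contra h
    have := Finset.mem_range.1 (hB (Finsupp.mem_support_iff.2 h))
    omega
  refine ⟨A + B + 1, fun m hm => ?_⟩
  cases m with
  | beta n u =>
    have : v.2 n.toNat = 0 := h2 _ (by simp only [Mode.idx] at hm; omega)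
    change -((v.2 n.toNat) u) = 0
    rw [this, LinearMap.zero_apply, neg_zero]
  | gamma n f =>
    have : v.1 (n - 1).toNat = 0 := h1 _ (by simp only [Mode.idx] at hm; omega)
    change f (v.1 (n - 1).toNat) = 0
    rw [this, map_zero]
  | b n u =>
    have : v.2 n.toNat = 0 := h2 _ (by simp only [Mode.idx] at hm; omega)
    change (v.2 n.toNat) u = 0
    rw [this, LinearMap.zero_apply]
  | c n f =>
    have : v.1 (n - 1).toNat = 0 := h1 _ (by simp only [Mode.idx] at hm; omega)
    change f (v.1 (n - 1).toNat) = 0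
    rw [this, map_zero]

theorem sym_eventually (p : SInf K ℓ) :
    ∃ N : ℤ, ∀ m : Mode K ℓ, N ≤ m.idx → symDeriv m.annFun p = 0 := by
  induction p using SymmetricAlgebra.induction with
  | algebraMap r => exact ⟨0, fun m _ => symDeriv_algebraMap _ _⟩
  | ι x =>
    obtain ⟨N, hN⟩ := annFun_eventually x
    exact ⟨N, fun m hm => by rw [symDeriv_ι, hN m hm, map_zero]⟩
  | mul p q hp hq =>
    obtain ⟨N, hN⟩ := hp
    obtain ⟨M, hM⟩ := hq
    exact ⟨max N M, fun m hm => by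
      rw [symDeriv_mul, hN m (le_trans (le_max_left _ _) hm),
        hM m (le_trans (le_max_right _ _) hm)]; simp⟩
  | add p q hp hq =>
    obtain ⟨N, hN⟩ := hp
    obtain ⟨M, hM⟩ := hq
    exact ⟨max N M, fun m hm => by
      rw [map_add, hN m (le_trans (le_max_left _ _) hm),
        hM m (le_trans (le_max_right _ _) hm), add_zero]⟩

theorem ext_eventually (p : ExtInf K ℓ) :
    ∃ N : ℤ, ∀ m : Mode K ℓ, N ≤ m.idx → extContract m.annFun p = 0 := by
  induction p using CliffordAlgebra.left_induction with
  | algebraMap r => exact ⟨0, fun m _ => extContract_algebraMap _ _⟩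
  | add p q hp hq =>
    obtain ⟨N, hN⟩ := hp
    obtain ⟨M, hM⟩ := hq
    exact ⟨max N M, fun m hm => by
      rw [map_add, hN m (le_trans (le_max_left _ _) hm),
        hM m (le_trans (le_max_right _ _) hm), add_zero]⟩
  | ι_mul p x hp =>
    obtain ⟨N, hN⟩ := hp
    obtain ⟨M, hM⟩ := annFun_eventually x
    exact ⟨max N M, fun m hm => by
      rw [extContract_ι_mul, hN m (le_trans (le_max_left _ _) hm),
        hM m (le_trans (le_max_right _ _) hm)]; simp⟩

theorem exists_killedFrom (w : W K ℓ) : ∃ N : ℤ, 1 ≤ N ∧ KilledFrom N w := by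
  induction w using TensorProduct.induction_on with
  | zero => exact ⟨1, le_rfl, fun m _ _ => map_zero _⟩
  | tmul p q =>
    obtain ⟨N, hN⟩ := sym_eventually p
    obtain ⟨M, hM⟩ := ext_eventually q
    refine ⟨max 1 (max N M), le_max_left _ _, fun m hm hc => ?_⟩
    have h1 := hN m (le_trans (le_trans (le_max_left _ _) (le_max_right _ _)) hm)
    have h2 := hM m (le_trans (le_trans (le_max_right _ _) (le_max_right _ _)) hm)
    unfold Mode.op
    rw [hc]
    cases m.isOdd
    · simp only [LinearMap.rTensor_tmul, h1, TensorProduct.zero_tmul]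
    · simp only [LinearMap.lTensor_tmul, h2, TensorProduct.tmul_zero]
  | add v w hv hw =>
    obtain ⟨N, hN1, hN⟩ := hv
    obtain ⟨M, hM1, hM⟩ := hw
    exact ⟨max N M, le_trans hN1 (le_max_left _ _), fun m hm hc => by
      rw [map_add, hN m (le_trans (le_max_left _ _) hm) hc,
        hM m (le_trans (le_max_right _ _) hm) hc, add_zero]⟩

theorem ann_op_comm (m m' : Mode K ℓ) (h : m.isCre = false) (h' : m'.isCre = false)
    (w : W K ℓ) : m.op (m'.op w) = m'.op (m.op w) ∨ m.op (m'.op w) = -m'.op (m.op w) := by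
  unfold Mode.op
  rw [h, h']
  cases m.isOdd <;> cases m'.isOdd
  · left
    simp only [← LinearMap.comp_apply, ← LinearMap.rTensor_comp]
    congr 2
    ext p
    exact symDeriv_comm _ _ _
  · left
    simp only [← LinearMap.comp_apply, LinearMap.rTensor_comp_lTensor,
      LinearMap.lTensor_comp_rTensor]
  · left
    simp only [← LinearMap.comp_apply, LinearMap.rTensor_comp_lTensor,
      LinearMap.lTensor_comp_rTensor]
  · right
    simp only [← LinearMap.comp_apply, ← LinearMap.lTensor_comp]
    rw [← LinearMap.neg_apply, ← LinearMap.lTensor_neg]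
    congr 2
    ext p
    exact extContract_comm _ _ _

theorem KilledFrom.op {N : ℤ} {w : W K ℓ} (hw : KilledFrom N w) (m : Mode K ℓ)
    (hm : m.isCre = false) : KilledFrom N (m.op w) := fun m' h' hc' => by
  rcases ann_op_comm m' m hc' hm w with h | h
  · rw [h, hw m' h' hc', map_zero]
  · rw [h, hw m' h' hc', map_zero, neg_zero]

theorem isCre_eq_false (m : Mode K ℓ) (h : 1 ≤ m.idx) : m.isCre = false := by
  cases m <;> simp only [Mode.idx] at h <;> simp only [Mode.isCre, decide_eq_false_iff_not] <;>
    omega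

theorem normalOrder_eq_zero {N : ℤ} (hN : 1 ≤ N) (l : List (Mode K ℓ)) :
    ∀ w : W K ℓ, KilledFrom N w → (∃ m ∈ l, N ≤ m.idx) → normalOrder l w = 0 := by
  induction l with
  | nil => rintro w _ ⟨m, hm, _⟩; simp at hm
  | cons x l ih =>
    rintro w hw ⟨m, hm, hmN⟩
    unfold normalOrder
    rcases hx : x.isCre with _ | _
    · have key : normalOrder l (x.op w) = 0 := by
        rcases List.mem_cons.1 hm with rfl | hm
        · rw [hw m hmN hx, map_zero]
        · exact ih _ (hw.op x hx) ⟨m, hm, hmN⟩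
      by_cases ho : (x.isOdd && isOddList l) = true
      · simp [ho, key]
      · simp [ho, key]
    · have hml : m ∈ l := by
        rcases List.mem_cons.1 hm with rfl | hm
        · rw [isCre_eq_false m (le_trans hN hmN)] at hx; simp at hx
        · exact hm
      simp [ih w hw ⟨m, hml, hmN⟩]

/-- A family of normally ordered products is locally finite if, for every bound, all but finitely
many members contain a mode of index above it. -/
theorem locFin_normalOrder {I : Type*} (L : I → List (Mode K ℓ))
    (h : ∀ N : ℤ, {i | ∀ m ∈ L i, m.idx < N}.Finite) : LocFin (fun i => normalOrder (L i)) := by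
  intro w
  obtain ⟨N, hN, hw⟩ := exists_killedFrom w
  refine (h N).subset fun i hi => ?_
  by_contra hc
  apply hi
  simp only [Set.mem_ofPred_eq, not_forall, not_lt] at hc
  obtain ⟨m, hm, hmN⟩ := hc
  exact normalOrder_eq_zero hN _ w hw ⟨m, hm, hmN⟩

/-! ### The action of the loop algebra and the differential -/

variable {ι : Type*} [Fintype ι]

/-- The summand of index `m` of `θ(x_n)`:
`∑_v :β_{n+m}^{[x,v]} γ_{-m}^{v'}: + ∑_v :b_{n+m}^{[x,v]} c_{-m}^{v'}:`. -/
def thetaTerm (e : Basis ι K ℓ) (x : ℓ) (n m : ℤ) : End K (W K ℓ) :=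
  ∑ v : ι, normalOrder [.beta (n + m) ⁅x, e v⁆, .gamma (-m) (e.coord v)] +
    ∑ v : ι, normalOrder [.b (n + m) ⁅x, e v⁆, .c (-m) (e.coord v)]

theorem thetaTerm_locFin (e : Basis ι K ℓ) (x : ℓ) (n : ℤ) : LocFin (thetaTerm e x n) := by
  have hfin : ∀ N : ℤ, {m : ℤ | n + m < N ∧ -m < N}.Finite := fun N =>
    (Set.finite_Icc (-N) (N - n)).subset fun m hm => by
      simp only [Set.mem_ofPred_eq, Set.mem_Icc] at hm ⊢; omega
  refine LocFin.add (LocFin.sum _ fun v => locFin_normalOrder _ fun N => ?_)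
    (LocFin.sum _ fun v => locFin_normalOrder _ fun N => ?_) <;>
  simpa [Mode.idx] using hfin N

/-- The operator `θ(x_n)` by which `x ⊗ t^n` acts. -/
def theta (e : Basis ι K ℓ) (x : ℓ) (n : ℤ) : End K (W K ℓ) :=
  opSum (thetaTerm e x n) (thetaTerm_locFin e x n)

/-- The `ℓ`-invariant vectors, `ℓ` being the subalgebra `ℓ ⊗ t^0` of the loop algebra. -/
def invariants (e : Basis ι K ℓ) : Submodule K (W K ℓ) :=
  ⨅ x : ℓ, LinearMap.ker (theta e x 0)

/-- The summand of index `(i, j)` of the differential: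
`∑_{u,v} :β_{i+j}^{[u,v]} γ_{-i}^{v'} c_{-j}^{u'}: + ½ ∑_{u,v} :b_{i+j}^{[u,v]} c_{-i}^{v'} c_{-j}^{u'}:`. -/
def QTerm (e : Basis ι K ℓ) (p : ℤ × ℤ) : End K (W K ℓ) :=
  ∑ u : ι, ∑ v : ι, normalOrder
      [.beta (p.1 + p.2) ⁅e u, e v⁆, .gamma (-p.1) (e.coord v), .c (-p.2) (e.coord u)] +
    (1 / 2 : K) • ∑ u : ι, ∑ v : ι, normalOrder
      [.b (p.1 + p.2) ⁅e u, e v⁆, .c (-p.1) (e.coord v), .c (-p.2) (e.coord u)]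

theorem QTerm_locFin (e : Basis ι K ℓ) : LocFin (QTerm e) := by
  have hfin : ∀ N : ℤ, {p : ℤ × ℤ | p.1 + p.2 < N ∧ -p.1 < N ∧ -p.2 < N}.Finite := fun N =>
    ((Set.finite_Icc (-N) (2 * N)).prod (Set.finite_Icc (-N) (2 * N))).subset fun p hp => by
      simp only [Set.mem_ofPred_eq, Set.mem_prod, Set.mem_Icc] at hp ⊢; omega
  refine LocFin.add (LocFin.sum _ fun u => LocFin.sum _ fun v => locFin_normalOrder _ fun N => ?_)
    (LocFin.smul _ (LocFin.sum _ fun u => LocFin.sum _ fun v => locFin_normalOrder _ fun N => ?_))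
  <;> simpa [Mode.idx] using hfin N

/-- The semi-infinite cohomology differential. -/
def Q (e : Basis ι K ℓ) : End K (W K ℓ) := opSum (QTerm e) (QTerm_locFin e)

end Fock

/-! ### The Killing isomorphism and the two states -/

section Killing

variable (K : Type*) [Field K] [CharZero K] (ℓ : Type*) [LieRing ℓ] [LieAlgebra K ℓ]
  [FiniteDimensional K ℓ] [LieAlgebra.IsSemisimple K ℓ]

/-- The Killing isomorphism `φ : ℓ → ℓ'`, `φ(u)(v) = tr (ad u ∘ ad v)`. -/
def killingEquiv : ℓ ≃ₗ[K] Dual K ℓ :=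
  LinearMap.BilinForm.toDual (killingForm K ℓ) (LieAlgebra.IsKilling.killingForm_nondegenerate K ℓ)

variable {K ℓ} {ι : Type*} [Fintype ι]

/-- `r = ∑_u γ_0^{φ(u)} c_{-1}^{u'} 1`. -/
def rState (e : Basis ι K ℓ) : W K ℓ :=
  ∑ u : ι, (Mode.gamma 0 (killingEquiv K ℓ (e u))).op ((Mode.c (-1) (e.coord u)).op (vac K ℓ))

/-- `t = ∑_u β_{-1}^{φ⁻¹(u')} b_{-1}^u 1`. -/
def tState (e : Basis ι K ℓ) : W K ℓ :=
  ∑ u : ι, (Mode.beta (-1) ((killingEquiv K ℓ).symm (e.coord u))).op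
    ((Mode.b (-1) (e u)).op (vac K ℓ))

end Killing

end VOWA

end

noncomputable section

namespace VOWA

open Module

/-! ### Calculus of the modes on the Fock module. -/

section Modes

variable {K : Type*} [Field K]

/-! Everything rests on the invariant symmetric tensor given by the Killing form. Write `y_k =
φ⁻¹(u_k')`. The Casimir tensor `∑ y_k ⊗ u_k` and the form `∑ φ(u_k) ⊗ u_k'` are `ad`-invariant
(`sum_lie_casimir`, `sum_adDual_killing`), and the Casimir tensor is symmetric (`sum_casimir_comm`).

Cocycles. On `γ_0 c_{-1} 1` and `β_{-1} b_{-1} 1` only finitely many summands of `θ(x_0)` and `Q`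
survive. `θ(x_0)` acts through the (co)adjoint action on the two labels, so invariance of the
tensors gives `θ(x_0) r = θ(x_0) t = 0`. On `γ_0 c_{-1} 1` the differential is `∑_u c_0^{u'}
θ(u_0)`, whence `Q r = 0`. On `β_{-1}^y b_{-1}^z 1` there are two further terms, `β_{-2}^{[z,y]} 1`
and `-∑_u γ_0^{u'} β_{-1}^{[u,z]} β_{-1}^y 1`; after summation over the Casimir tensor the first
vanishes because the bracket is antisymmetric, the second because the `β`'s commute.

Nontriviality. For each state there is a linear functional that vanishes on the image of `Q` but not
on the state. For `t` any coefficient of `β_{-1} b_{-1}` will do: no summand of `Q` can produce such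
a monomial (`vacCoeff_gamma_c_Q`). For `r` the coefficients of `γ_0 c_{-1}` and `γ_{-1} c_0` are
contracted with the Casimir tensor and added (`rDual`). On the image of `Q` all contributions cancel
by the same three properties of the tensor (`rDual_Q`), while the value on `r` is `-dim ℓ`, which is
nonzero in characteristic zero. -/

theorem symDeriv_add_left {V : Type*} [AddCommGroup V] [Module K V] (d d' : Dual K V)
    (p : SymmetricAlgebra K V) : symDeriv (d + d') p = symDeriv d p + symDeriv d' p := by
  induction p using SymmetricAlgebra.induction with
  | algebraMap r => simp [symDeriv_algebraMap]
  | ι x => simp [symDeriv_ι]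
  | mul a b ha hb => simp only [symDeriv_mul, ha, hb]; ring
  | add a b ha hb => simp only [map_add, ha, hb]; abel

theorem symDeriv_smul_left {V : Type*} [AddCommGroup V] [Module K V] (a : K) (d : Dual K V)
    (p : SymmetricAlgebra K V) : symDeriv (a • d) p = a • symDeriv d p := by
  induction p using SymmetricAlgebra.induction with
  | algebraMap r => simp [symDeriv_algebraMap]
  | ι x => simp [symDeriv_ι, Algebra.smul_def]
  | mul x y hx hy => simp only [symDeriv_mul, hx, hy, smul_add, mul_smul_comm]
  | add x y hx hy => simp only [map_add, hx, hy, smul_add]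

variable {ℓ : Type*} [LieRing ℓ] [LieAlgebra K ℓ]

theorem op_even_creation {m : Mode K ℓ} (ho : m.isOdd = false) (hc : m.isCre = true) :
    m.op = LinearMap.rTensor _ (LinearMap.mulLeft K (SymmetricAlgebra.ι K _ m.creVec)) := by
  unfold Mode.op; rw [ho, hc]

theorem op_even_annihilation {m : Mode K ℓ} (ho : m.isOdd = false) (hc : m.isCre = false) :
    m.op = LinearMap.rTensor _ (symDeriv m.annFun) := by
  unfold Mode.op; rw [ho, hc]

theorem op_odd_creation {m : Mode K ℓ} (ho : m.isOdd = true) (hc : m.isCre = true) :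
    m.op = LinearMap.lTensor _ (LinearMap.mulLeft K (ExteriorAlgebra.ι K m.creVec)) := by
  unfold Mode.op; rw [ho, hc]

theorem op_odd_annihilation {m : Mode K ℓ} (ho : m.isOdd = true) (hc : m.isCre = false) :
    m.op = LinearMap.lTensor _ (extContract m.annFun) := by
  unfold Mode.op; rw [ho, hc]

theorem op_even_odd_comm {m m' : Mode K ℓ} (h : m.isOdd = false) (h' : m'.isOdd = true)
    (w : W K ℓ) : m.op (m'.op w) = m'.op (m.op w) := by
  unfold Mode.op
  rw [h, h']
  cases m.isCre <;> cases m'.isCre <;>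
  simp only [← LinearMap.comp_apply, LinearMap.rTensor_comp_lTensor,
      LinearMap.lTensor_comp_rTensor]

theorem op_annihilation_creation_even {m m' : Mode K ℓ} (h : m.isOdd = false)
    (h' : m'.isOdd = false) (hm : m.isCre = false) (hm' : m'.isCre = true) (w : W K ℓ) :
    m.op (m'.op w) = m'.op (m.op w) + m.annFun m'.creVec • w := by
  rw [op_even_annihilation h hm, op_even_creation h' hm']
  induction w using TensorProduct.induction_on with
  | zero => simp
  | add v w hv hw => simp only [map_add, hv, hw, smul_add]; abel
  | tmul p q =>
    simp only [LinearMap.rTensor_tmul, LinearMap.mulLeft_apply, symDeriv_mul, symDeriv_ι,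
      TensorProduct.add_tmul]
    rw [mul_comm p, ← Algebra.smul_def, TensorProduct.smul_tmul']

theorem op_annihilation_creation_odd {m m' : Mode K ℓ} (h : m.isOdd = true)
    (h' : m'.isOdd = true) (hm : m.isCre = false) (hm' : m'.isCre = true) (w : W K ℓ) :
    m.op (m'.op w) = -m'.op (m.op w) + m.annFun m'.creVec • w := by
  rw [op_odd_annihilation h hm, op_odd_creation h' hm']
  induction w using TensorProduct.induction_on with
  | zero => simp
  | add v w hv hw => simp only [map_add, hv, hw, smul_add]; abel
  | tmul p q =>
    simp only [LinearMap.lTensor_tmul, LinearMap.mulLeft_apply, extContract_ι_mul,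
      TensorProduct.tmul_sub, TensorProduct.tmul_smul]
    abel

theorem op_creation_creation_even {m m' : Mode K ℓ} (h : m.isOdd = false)
    (h' : m'.isOdd = false) (hm : m.isCre = true) (hm' : m'.isCre = true) (w : W K ℓ) :
    m.op (m'.op w) = m'.op (m.op w) := by
  rw [op_even_creation h hm, op_even_creation h' hm']
  simp only [← LinearMap.comp_apply, ← LinearMap.rTensor_comp]
  congr 2
  ext p
  simp only [LinearMap.comp_apply, LinearMap.mulLeft_apply]
  ring

theorem op_creation_creation_odd {m m' : Mode K ℓ} (h : m.isOdd = true)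
    (h' : m'.isOdd = true) (hm : m.isCre = true) (hm' : m'.isCre = true) (w : W K ℓ) :
    m.op (m'.op w) = -m'.op (m.op w) := by
  rw [op_odd_creation h hm, op_odd_creation h' hm']
  induction w using TensorProduct.induction_on with
  | zero => simp
  | add v w hv hw => simp only [map_add, hv, hw]; abel
  | tmul p q =>
    simp only [LinearMap.lTensor_tmul, LinearMap.mulLeft_apply, ← TensorProduct.tmul_neg]
    congr 1
    rw [← mul_assoc, ← mul_assoc, ← neg_mul, ← sub_eq_zero, ← sub_mul, sub_neg_eq_add,
      ExteriorAlgebra.ι_add_mul_swap, zero_mul]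

theorem op_annihilation_even_comm {m m' : Mode K ℓ} (h : m.isOdd = false)
    (h' : m'.isOdd = false) (hm : m.isCre = false) (hm' : m'.isCre = false) (w : W K ℓ) :
    m.op (m'.op w) = m'.op (m.op w) := by
  rw [op_even_annihilation h hm, op_even_annihilation h' hm']
  simp only [← LinearMap.comp_apply, ← LinearMap.rTensor_comp]
  congr 2
  ext p
  exact symDeriv_comm _ _ _

theorem op_annihilation_odd_comm {m m' : Mode K ℓ} (h : m.isOdd = true)
    (h' : m'.isOdd = true) (hm : m.isCre = false) (hm' : m'.isCre = false) (w : W K ℓ) :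
    m.op (m'.op w) = -m'.op (m.op w) := by
  rw [op_odd_annihilation h hm, op_odd_annihilation h' hm']
  simp only [← LinearMap.comp_apply, ← LinearMap.lTensor_comp]
  rw [← LinearMap.neg_apply, ← LinearMap.lTensor_neg]
  congr 2
  ext p
  exact extContract_comm _ _ _

theorem creation_op_comm (m m' : Mode K ℓ) (h : m.isCre = true) (h' : m'.isCre = true)
    (w : W K ℓ) : m.op (m'.op w) = m'.op (m.op w) ∨ m.op (m'.op w) = -m'.op (m.op w) := by
  rcases ho : m.isOdd with _ | _ <;> rcases ho' : m'.isOdd with _ | _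
  · exact .inl (op_creation_creation_even ho ho' h h' w)
  · exact .inl (op_even_odd_comm ho ho' w)
  · exact .inl (op_even_odd_comm ho' ho w).symm
  · exact .inr (op_creation_creation_odd ho ho' h h' w)

theorem op_vac {m : Mode K ℓ} (h : m.isCre = false) : m.op (vac K ℓ) = 0 := by
  rcases ho : m.isOdd with _ | _
  · rw [op_even_annihilation ho h, vac, LinearMap.rTensor_tmul,
      ← map_one (algebraMap K (SInf K ℓ)), symDeriv_algebraMap, TensorProduct.zero_tmul]
  · rw [op_odd_annihilation ho h, vac, LinearMap.lTensor_tmul,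
      ← map_one (algebraMap K (ExtInf K ℓ)), extContract_algebraMap, TensorProduct.tmul_zero]

/-- The coefficient of the vacuum. -/
def vacCoeff : W K ℓ →ₗ[K] K :=
  LinearMap.mul' K K ∘ₗ TensorProduct.map
    (SymmetricAlgebra.algebraMapInv (R := K) (M := Cre K ℓ)).toLinearMap
    (ExteriorAlgebra.algebraMapInv (R := K) (M := Cre K ℓ)).toLinearMap

@[simp]
theorem vacCoeff_vac : vacCoeff (vac K ℓ) = 1 := by
  simp [vacCoeff, vac]

theorem vacCoeff_op {m : Mode K ℓ} (h : m.isCre = true) (w : W K ℓ) :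
    vacCoeff (m.op w) = 0 := by
  induction w using TensorProduct.induction_on with
  | zero => simp
  | add v w hv hw => simp only [map_add, hv, hw, add_zero]
  | tmul p q =>
    rcases ho : m.isOdd with _ | _
    · rw [op_even_creation ho h]
      simp [vacCoeff, SymmetricAlgebra.algebraMapInv_ι]
    · rw [op_odd_creation ho h]
      simp [vacCoeff, ExteriorAlgebra.algebraMapInv]

/-! ### Linearity of the modes in their label -/

/-- An operator is linear in `creVec` or in `annFun`, according to its type. For a fixed index both
of these are linear in the label, even the one that `op` ignores, so requiring both avoids a case
distinction on the sign of the index. -/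
theorem op_add_of {m m₁ m₂ : Mode K ℓ} (ho₁ : m₁.isOdd = m.isOdd) (hc₁ : m₁.isCre = m.isCre)
    (ho₂ : m₂.isOdd = m.isOdd) (hc₂ : m₂.isCre = m.isCre) (hv : m.creVec = m₁.creVec + m₂.creVec)
    (hf : m.annFun = m₁.annFun + m₂.annFun) : m.op = m₁.op + m₂.op := by
  refine LinearMap.ext fun w => ?_
  unfold Mode.op
  rw [ho₁, hc₁, ho₂, hc₂, hv, hf]
  cases m.isOdd <;> cases m.isCre <;> dsimp only <;>
  induction w using TensorProduct.induction_on with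
  | zero => simp
  | add v w ihv ihw => rw [map_add, ihv, ihw, map_add]
  | tmul p q =>
    simp [symDeriv_add_left, extContract, add_mul, TensorProduct.add_tmul, TensorProduct.tmul_add]

theorem op_smul_of {m m₁ : Mode K ℓ} (a : K) (ho₁ : m₁.isOdd = m.isOdd)
    (hc₁ : m₁.isCre = m.isCre) (hv : m.creVec = a • m₁.creVec)
    (hf : m.annFun = a • m₁.annFun) : m.op = a • m₁.op := by
  refine LinearMap.ext fun w => ?_
  unfold Mode.op
  rw [ho₁, hc₁, hv, hf]
  cases m.isOdd <;> cases m.isCre <;> dsimp only <;>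
  induction w using TensorProduct.induction_on with
  | zero => simp
  | add v w ihv ihw => rw [map_add, ihv, ihw, map_add]
  | tmul p q =>
    simp [symDeriv_smul_left, extContract, TensorProduct.smul_tmul']

theorem cre_ext {v w : Cre K ℓ} (h₁ : v.1 = w.1) (h₂ : v.2 = w.2) : v = w := Prod.ext h₁ h₂

/-- The operators `β_n^x`, as a linear map in `x`. -/
def opBeta (n : ℤ) : ℓ →ₗ[K] End K (W K ℓ) where
  toFun x := (Mode.beta n x).op
  map_add' x y := op_add_of rfl rfl rfl rfl
    (cre_ext (Finsupp.single_add _ _ _) (add_zero _).symm)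
    (by simp only [Mode.annFun, evalSnd, map_add, LinearMap.add_comp, neg_add])
  map_smul' a x := op_smul_of a rfl rfl
    (cre_ext (Finsupp.smul_single _ _ _).symm (smul_zero _).symm)
    (by simp only [Mode.annFun, evalSnd, map_smul, LinearMap.smul_comp, smul_neg])

/-- The operators `γ_n^f`, as a linear map in `f`. -/
def opGamma (n : ℤ) : Dual K ℓ →ₗ[K] End K (W K ℓ) where
  toFun f := (Mode.gamma n f).op
  map_add' x y := op_add_of rfl rfl rfl rfl
    (cre_ext (add_zero _).symm (Finsupp.single_add _ _ _))
    (by simp only [Mode.annFun, evalFst, LinearMap.add_comp])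
  map_smul' a x := op_smul_of a rfl rfl
    (cre_ext (smul_zero _).symm (Finsupp.smul_single _ _ _).symm)
    (by simp only [Mode.annFun, evalFst, LinearMap.smul_comp])

/-- The operators `b_n^x`, as a linear map in `x`. -/
def opB (n : ℤ) : ℓ →ₗ[K] End K (W K ℓ) where
  toFun x := (Mode.b n x).op
  map_add' x y := op_add_of rfl rfl rfl rfl
    (cre_ext (Finsupp.single_add _ _ _) (add_zero _).symm)
    (by simp only [Mode.annFun, evalSnd, map_add, LinearMap.add_comp])
  map_smul' a x := op_smul_of a rfl rfl
    (cre_ext (Finsupp.smul_single _ _ _).symm (smul_zero _).symm)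
    (by simp only [Mode.annFun, evalSnd, map_smul, LinearMap.smul_comp])

/-- The operators `c_n^f`, as a linear map in `f`. -/
def opC (n : ℤ) : Dual K ℓ →ₗ[K] End K (W K ℓ) where
  toFun f := (Mode.c n f).op
  map_add' x y := op_add_of rfl rfl rfl rfl
    (cre_ext (add_zero _).symm (Finsupp.single_add _ _ _))
    (by simp only [Mode.annFun, evalFst, LinearMap.add_comp])
  map_smul' a x := op_smul_of a rfl rfl
    (cre_ext (smul_zero _).symm (Finsupp.smul_single _ _ _).symm)
    (by simp only [Mode.annFun, evalFst, LinearMap.smul_comp])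

@[simp]
theorem op_beta (n : ℤ) (x : ℓ) : (Mode.beta n x : Mode K ℓ).op = opBeta n x := rfl

@[simp]
theorem op_gamma (n : ℤ) (f : Dual K ℓ) : (Mode.gamma n f).op = opGamma n f := rfl

@[simp]
theorem op_b (n : ℤ) (x : ℓ) : (Mode.b n x : Mode K ℓ).op = opB n x := rfl

@[simp]
theorem op_c (n : ℤ) (f : Dual K ℓ) : (Mode.c n f).op = opC n f := rfl

/-! ### Canonical (anti)commutation relations -/

@[simp]
theorem beta_gamma {n k : ℤ} (hn : 0 ≤ n) (hk : k ≤ 0) (x : ℓ) (f : Dual K ℓ) (w : W K ℓ) :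
    opBeta n x (opGamma k f w) =
      opGamma k f (opBeta n x w) - (if n + k = 0 then f x else 0) • w := by
  have h := op_annihilation_creation_even (m := Mode.beta n x) (m' := Mode.gamma k f) rfl rfl
    (by simp [Mode.isCre]; omega) (by simp [Mode.isCre, hk]) w
  rw [op_beta, op_gamma] at h
  rw [h, sub_eq_add_neg]
  refine congrArg _ (Eq.trans ?_ (neg_smul _ _))
  congr 1
  change -((Finsupp.single (-k).toNat f n.toNat) x) = _
  rw [Finsupp.single_apply]
  -- The signs of `n` and `k` make both `toNat`s exact, so the two slots agree precisely when `n + k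
  -- = 0`.
  by_cases h0 : n + k = 0
  · rw [if_pos (by omega), if_pos h0]
  · rw [if_neg (by omega), if_neg h0, LinearMap.zero_apply]

@[simp]
theorem gamma_beta {n k : ℤ} (hn : 1 ≤ n) (hk : k ≤ -1) (f : Dual K ℓ) (x : ℓ) (w : W K ℓ) :
    opGamma n f (opBeta k x w) =
      opBeta k x (opGamma n f w) + (if n + k = 0 then f x else 0) • w := by
  have h := op_annihilation_creation_even (m := Mode.gamma n f) (m' := Mode.beta k x) rfl rfl
    (by simp [Mode.isCre]; omega) (by simp [Mode.isCre, hk]) w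
  rw [op_beta, op_gamma] at h
  rw [h]
  congr 2
  change f (Finsupp.single (-k - 1).toNat x (n - 1).toNat) = _
  rw [Finsupp.single_apply]
  by_cases h0 : n + k = 0
  · rw [if_pos (by omega), if_pos h0]
  · rw [if_neg (by omega), if_neg h0, map_zero]

@[simp]
theorem b_c {n k : ℤ} (hn : 0 ≤ n) (hk : k ≤ 0) (x : ℓ) (f : Dual K ℓ) (w : W K ℓ) :
    opB n x (opC k f w) =
      -opC k f (opB n x w) + (if n + k = 0 then f x else 0) • w := by
  have h := op_annihilation_creation_odd (m := Mode.b n x) (m' := Mode.c k f) rfl rfl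
    (by simp [Mode.isCre]; omega) (by simp [Mode.isCre, hk]) w
  rw [op_b, op_c] at h
  rw [h]
  congr 2
  change (Finsupp.single (-k).toNat f n.toNat) x = _
  rw [Finsupp.single_apply]
  by_cases h0 : n + k = 0
  · rw [if_pos (by omega), if_pos h0]
  · rw [if_neg (by omega), if_neg h0, LinearMap.zero_apply]

@[simp]
theorem c_b {n k : ℤ} (hn : 1 ≤ n) (hk : k ≤ -1) (f : Dual K ℓ) (x : ℓ) (w : W K ℓ) :
    opC n f (opB k x w) =
      -opB k x (opC n f w) + (if n + k = 0 then f x else 0) • w := by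
  have h := op_annihilation_creation_odd (m := Mode.c n f) (m' := Mode.b k x) rfl rfl
    (by simp [Mode.isCre]; omega) (by simp [Mode.isCre, hk]) w
  rw [op_b, op_c] at h
  rw [h]
  congr 2
  change f (Finsupp.single (-k - 1).toNat x (n - 1).toNat) = _
  rw [Finsupp.single_apply]
  by_cases h0 : n + k = 0
  · rw [if_pos (by omega), if_pos h0]
  · rw [if_neg (by omega), if_neg h0, map_zero]

@[simp]
theorem beta_beta {n k : ℤ} (hn : 0 ≤ n) (hk : k ≤ -1) (x y : ℓ) (w : W K ℓ) :
    opBeta n x (opBeta k y w) = opBeta k y (opBeta n x w) := by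
  have h := op_annihilation_creation_even (m := Mode.beta n x) (m' := Mode.beta k y) rfl rfl
    (by simp [Mode.isCre]; omega) (by simp [Mode.isCre, hk]) w
  rw [op_beta, op_beta] at h
  rw [h, add_eq_left]
  change (-(0 : K)) • w = 0
  rw [neg_zero, zero_smul]

@[simp]
theorem gamma_gamma {n k : ℤ} (hn : 1 ≤ n) (hk : k ≤ 0) (f g : Dual K ℓ) (w : W K ℓ) :
    opGamma n f (opGamma k g w) = opGamma k g (opGamma n f w) := by
  have h := op_annihilation_creation_even (m := Mode.gamma n f) (m' := Mode.gamma k g) rfl rfl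
    (by simp [Mode.isCre]; omega) (by simp [Mode.isCre, hk]) w
  rw [op_gamma, op_gamma] at h
  rw [h, add_eq_left]
  change f 0 • w = 0
  rw [map_zero, zero_smul]

@[simp]
theorem b_b {n k : ℤ} (hn : 0 ≤ n) (hk : k ≤ -1) (x y : ℓ) (w : W K ℓ) :
    opB n x (opB k y w) = -opB k y (opB n x w) := by
  have h := op_annihilation_creation_odd (m := Mode.b n x) (m' := Mode.b k y) rfl rfl
    (by simp [Mode.isCre]; omega) (by simp [Mode.isCre, hk]) w
  rw [op_b, op_b] at h
  rw [h, add_eq_left]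
  change (0 : K) • w = 0
  rw [zero_smul]

@[simp]
theorem c_c {n k : ℤ} (hn : 1 ≤ n) (hk : k ≤ 0) (f g : Dual K ℓ) (w : W K ℓ) :
    opC n f (opC k g w) = -opC k g (opC n f w) := by
  have h := op_annihilation_creation_odd (m := Mode.c n f) (m' := Mode.c k g) rfl rfl
    (by simp [Mode.isCre]; omega) (by simp [Mode.isCre, hk]) w
  rw [op_c, op_c] at h
  rw [h, add_eq_left]
  change f 0 • w = 0
  rw [map_zero, zero_smul]

-- The side conditions of this and the following even-odd rules orient the rewriting: creation
-- operators go left of annihilation operators, and within either kind the even ones go left of the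
-- odd ones. No pair can be swapped back and forth by `simp`.
@[simp]
theorem b_beta {n k : ℤ} (_ : 0 ≤ n ∨ k ≤ -1) (x : ℓ) (y : ℓ) (w : W K ℓ) :
    opB n x (opBeta k y w) = opBeta k y (opB n x w) :=
  (op_even_odd_comm (m := .beta k y) (m' := .b n x) rfl rfl w).symm

@[simp]
theorem beta_b {n k : ℤ} (_ : 0 ≤ n) (_ : k ≤ -1) (y : ℓ) (x : ℓ) (w : W K ℓ) :
    opBeta n y (opB k x w) = opB k x (opBeta n y w) :=
  op_even_odd_comm (m := .beta n y) (m' := .b k x) rfl rfl w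

@[simp]
theorem b_gamma {n k : ℤ} (_ : 0 ≤ n ∨ k ≤ 0) (x : ℓ) (g : Dual K ℓ) (w : W K ℓ) :
    opB n x (opGamma k g w) = opGamma k g (opB n x w) :=
  (op_even_odd_comm (m := .gamma k g) (m' := .b n x) rfl rfl w).symm

@[simp]
theorem gamma_b {n k : ℤ} (_ : 1 ≤ n) (_ : k ≤ -1) (g : Dual K ℓ) (x : ℓ) (w : W K ℓ) :
    opGamma n g (opB k x w) = opB k x (opGamma n g w) :=
  op_even_odd_comm (m := .gamma n g) (m' := .b k x) rfl rfl w

@[simp]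
theorem c_beta {n k : ℤ} (_ : 1 ≤ n ∨ k ≤ -1) (f : Dual K ℓ) (y : ℓ) (w : W K ℓ) :
    opC n f (opBeta k y w) = opBeta k y (opC n f w) :=
  (op_even_odd_comm (m := .beta k y) (m' := .c n f) rfl rfl w).symm

@[simp]
theorem beta_c {n k : ℤ} (_ : 0 ≤ n) (_ : k ≤ 0) (y : ℓ) (f : Dual K ℓ) (w : W K ℓ) :
    opBeta n y (opC k f w) = opC k f (opBeta n y w) :=
  op_even_odd_comm (m := .beta n y) (m' := .c k f) rfl rfl w

@[simp]
theorem c_gamma {n k : ℤ} (_ : 1 ≤ n ∨ k ≤ 0) (f : Dual K ℓ) (g : Dual K ℓ) (w : W K ℓ) :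
    opC n f (opGamma k g w) = opGamma k g (opC n f w) :=
  (op_even_odd_comm (m := .gamma k g) (m' := .c n f) rfl rfl w).symm

@[simp]
theorem gamma_c {n k : ℤ} (_ : 1 ≤ n) (_ : k ≤ 0) (g : Dual K ℓ) (f : Dual K ℓ) (w : W K ℓ) :
    opGamma n g (opC k f w) = opC k f (opGamma n g w) :=
  op_even_odd_comm (m := .gamma n g) (m' := .c k f) rfl rfl w

@[simp]
theorem beta_vac {n : ℤ} (h : 0 ≤ n) (x : ℓ) : opBeta n x (vac K ℓ) = 0 :=
  op_vac (m := .beta n x) (by simp [Mode.isCre]; omega)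

@[simp]
theorem gamma_vac {n : ℤ} (h : 1 ≤ n) (f : Dual K ℓ) : opGamma n f (vac K ℓ) = 0 :=
  op_vac (m := .gamma n f) (by simp [Mode.isCre]; omega)

@[simp]
theorem b_vac {n : ℤ} (h : 0 ≤ n) (x : ℓ) : opB n x (vac K ℓ) = 0 :=
  op_vac (m := .b n x) (by simp [Mode.isCre]; omega)

@[simp]
theorem c_vac {n : ℤ} (h : 1 ≤ n) (f : Dual K ℓ) : opC n f (vac K ℓ) = 0 :=
  op_vac (m := .c n f) (by simp [Mode.isCre]; omega)

@[simp]
theorem vacCoeff_beta {n : ℤ} (h : n ≤ -1) (x : ℓ) (w : W K ℓ) : vacCoeff (opBeta n x w) = 0 :=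
  vacCoeff_op (m := .beta n x) (by simp [Mode.isCre, h]) w

@[simp]
theorem vacCoeff_gamma {n : ℤ} (h : n ≤ 0) (f : Dual K ℓ) (w : W K ℓ) :
    vacCoeff (opGamma n f w) = 0 :=
  vacCoeff_op (m := .gamma n f) (by simp [Mode.isCre, h]) w

@[simp]
theorem vacCoeff_b {n : ℤ} (h : n ≤ -1) (x : ℓ) (w : W K ℓ) : vacCoeff (opB n x w) = 0 :=
  vacCoeff_op (m := .b n x) (by simp [Mode.isCre, h]) w

@[simp]
theorem vacCoeff_c {n : ℤ} (h : n ≤ 0) (f : Dual K ℓ) (w : W K ℓ) : vacCoeff (opC n f w) = 0 :=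
  vacCoeff_op (m := .c n f) (by simp [Mode.isCre, h]) w

@[simp]
theorem vacCoeff_beta_beta {n k : ℤ} (hn : 0 ≤ n) (hk : k ≤ -1) (x y : ℓ) (w : W K ℓ) :
    vacCoeff (opBeta n x (opBeta k y w)) = 0 := by
  rw [beta_beta hn hk, vacCoeff_beta hk]

/-! ### Vanishing of normally ordered products and evaluation of locally finite sums -/

/-- Normal ordering gathers the annihilation operators on the right, where they commute up to sign,
so any one of them may be made to act first. This bounds the summands that matter on a given state.
-/
theorem normalOrder_apply_eq_zero (l : List (Mode K ℓ)) :
    ∀ w : W K ℓ, (∃ m ∈ l, m.isCre = false ∧ m.op w = 0) → normalOrder l w = 0 := by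
  induction l with
  | nil => rintro w ⟨m, hm, _⟩; simp at hm
  | cons x l ih =>
    rintro w ⟨m, hm, hc, hw⟩
    unfold normalOrder
    rcases hx : x.isCre with _ | _
    · have key : normalOrder l (x.op w) = 0 := by
        rcases List.mem_cons.1 hm with rfl | hm
        · rw [hw, map_zero]
        · refine ih _ ⟨m, hm, hc, ?_⟩
          rcases ann_op_comm m x hc hx w with h | h <;> simp [h, hw]
      by_cases ho : (x.isOdd && isOddList l) = true
      · simp [ho, key]
      · simp [ho, key]
    · have hml : m ∈ l := by
        rcases List.mem_cons.1 hm with rfl | hm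
        · rw [hc] at hx; simp at hx
        · exact hm
      simp [ih w ⟨m, hml, hc, hw⟩]

/-- The dual principle: creation operators gather on the left and commute up to sign, so any one of
them may be made to act last, just before `η`. -/
theorem comp_normalOrder_eq_zero (l : List (Mode K ℓ)) :
    ∀ η : W K ℓ →ₗ[K] K, (∃ m ∈ l, m.isCre = true ∧ ∀ w, η (m.op w) = 0) →
      ∀ w, η (normalOrder l w) = 0 := by
  induction l with
  | nil => rintro η ⟨m, hm, _⟩; simp at hm
  | cons x l ih =>
    rintro η ⟨m, hm, hc, hw⟩ w
    unfold normalOrder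
    rcases hx : x.isCre with _ | _
    · have hml : m ∈ l := by
        rcases List.mem_cons.1 hm with rfl | hm
        · rw [hc] at hx; simp at hx
        · exact hm
      have key := ih η ⟨m, hml, hc, hw⟩
      by_cases ho : (x.isOdd && isOddList l) = true
      · simp [ho, key]
      · simp [ho, key]
    · simp only [if_true, Module.End.mul_apply]
      rcases List.mem_cons.1 hm with rfl | hm
      · exact hw _
      -- The leading creation operator is absorbed into the functional, which still kills the image
      -- of `m` since the two commute up to sign.
      · refine ih (η ∘ₗ x.op) ⟨m, hm, hc, fun v => ?_⟩ w
        rcases creation_op_comm x m hx hc v with h | h <;> simp [h, hw]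

theorem opSum_apply_eq_sum {I : Type*} {T : I → End K (W K ℓ)} (hT : LocFin T) (w : W K ℓ)
    (s : Finset I) (h : ∀ i ∉ s, T i w = 0) : opSum T hT w = ∑ i ∈ s, T i w :=
  finsum_eq_sum_of_support_subset _ fun i hi => by
    by_contra hc
    exact hi (h i hc)

/-- The summands supporting `opSum T hT w` depend on `w`; after applying `η` a single finite set `s`
can serve every `w`, which is what functionals on the image of `Q` need. -/
theorem map_opSum_eq_sum {I : Type*} {T : I → End K (W K ℓ)} (hT : LocFin T)
    (η : W K ℓ →ₗ[K] K) (w : W K ℓ) (s : Finset I) (h : ∀ i ∉ s, η (T i w) = 0) :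
    η (opSum T hT w) = ∑ i ∈ s, η (T i w) := by
  change η (∑ᶠ i, T i w) = _
  rw [map_finsum η (hT w)]
  exact finsum_eq_sum_of_support_subset _ fun i hi => by
    by_contra hc
    exact hi (h i hc)

end Modes

/-! ### Dual bases and the invariant tensors of the Killing form. -/

section Invariance

variable {K : Type*} [Field K] {ℓ : Type*} [LieRing ℓ] [LieAlgebra K ℓ]
  {ι : Type*} [Fintype ι] {M : Type*} [AddCommGroup M] [Module K M]

theorem sum_coord_smul_map (e : Basis ι K ℓ) (T : ℓ →ₗ[K] M) (y : ℓ) :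
    ∑ v, e.coord v y • T (e v) = T y := by
  simp only [← map_smul, ← map_sum, Basis.coord_apply, e.sum_repr]

theorem sum_repr_smul_map_lie (e : Basis ι K ℓ) (T : ℓ →ₗ[K] M) (x y : ℓ) :
    ∑ v, e.repr y v • T ⁅x, e v⁆ = T ⁅x, y⁆ :=
  sum_coord_smul_map e (T ∘ₗ (LieAlgebra.ad K ℓ x : ℓ →ₗ[K] ℓ)) y

theorem sum_repr_smul_map_lie' (e : Basis ι K ℓ) (T : ℓ →ₗ[K] M) (x y : ℓ) :
    ∑ v, e.repr y v • T ⁅e v, x⁆ = T ⁅y, x⁆ := by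
  simp only [← lie_skew _ x, map_neg, smul_neg, Finset.sum_neg_distrib, sum_repr_smul_map_lie]

theorem sum_apply_smul_map_coord (e : Basis ι K ℓ) (T : Dual K ℓ →ₗ[K] M) (f : Dual K ℓ) :
    ∑ v, f (e v) • T (e.coord v) = T f := by
  simp only [← map_smul, ← map_sum, e.sum_dual_apply_smul_coord]

/-- The transpose of `ad x`. -/
def adDual (x : ℓ) (f : Dual K ℓ) : Dual K ℓ := f ∘ₗ (LieAlgebra.ad K ℓ x : ℓ →ₗ[K] ℓ)

theorem sum_lie_smul_map_coord (e : Basis ι K ℓ) (T : Dual K ℓ →ₗ[K] M) (f : Dual K ℓ) (x : ℓ) :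
    ∑ v, f ⁅x, e v⁆ • T (e.coord v) = T (adDual x f) :=
  sum_apply_smul_map_coord e T (adDual x f)

theorem sum_lie_smul_map_coord' (e : Basis ι K ℓ) (T : Dual K ℓ →ₗ[K] M) (f : Dual K ℓ) (x : ℓ) :
    ∑ v, f ⁅e v, x⁆ • T (e.coord v) = -T (adDual x f) := by
  rw [← sum_lie_smul_map_coord e, ← Finset.sum_neg_distrib]
  refine Finset.sum_congr rfl fun v _ => ?_
  rw [← lie_skew, map_neg, neg_smul]

/-- Invariance of the canonical element of `ℓ ⊗ ℓ'`: both sides expand into the same double sum over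
the matrix entries of `ad x`. As `adDual x` is the transpose without sign, it is minus the coadjoint
action. -/
theorem sum_map_lie_coord (e : Basis ι K ℓ) (B : ℓ →ₗ[K] Dual K ℓ →ₗ[K] M) (x : ℓ) :
    ∑ k, B ⁅x, e k⁆ (e.coord k) = ∑ k, B (e k) (adDual x (e.coord k)) := by
  have h1 : ∀ k, B ⁅x, e k⁆ (e.coord k) = ∑ l, e.coord l ⁅x, e k⁆ • B (e l) (e.coord k) := by
    intro k
    exact (sum_coord_smul_map e (B.flip (e.coord k)) ⁅x, e k⁆).symm
  have h2 : ∀ k, B (e k) (adDual x (e.coord k)) =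
      ∑ l, e.coord k ⁅x, e l⁆ • B (e k) (e.coord l) := by
    intro k
    exact (sum_lie_smul_map_coord e (B (e k)) (e.coord k) x).symm
  simp only [h1, h2]
  exact Finset.sum_comm

variable [CharZero K] [FiniteDimensional K ℓ] [LieAlgebra.IsSemisimple K ℓ]

theorem killingEquiv_comm (x y : ℓ) : killingEquiv K ℓ x y = killingEquiv K ℓ y x :=
  LieModule.traceForm_comm K ℓ ℓ x y

theorem adDual_killingEquiv (x y : ℓ) :
    adDual x (killingEquiv K ℓ y) = -killingEquiv K ℓ ⁅x, y⁆ := by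
  ext z
  change killingForm K ℓ y ⁅x, z⁆ = -killingForm K ℓ ⁅x, y⁆ z
  rw [← LieModule.traceForm_apply_lie_apply, ← lie_skew, map_neg, LinearMap.neg_apply]

theorem lie_killingEquiv_symm (x : ℓ) (f : Dual K ℓ) :
    ⁅x, (killingEquiv K ℓ).symm f⁆ = -(killingEquiv K ℓ).symm (adDual x f) := by
  apply (killingEquiv K ℓ).injective
  rw [map_neg, LinearEquiv.apply_symm_apply, ← neg_eq_iff_eq_neg, ← adDual_killingEquiv,
    LinearEquiv.apply_symm_apply]

theorem sum_adDual_killing (e : Basis ι K ℓ) (B : Dual K ℓ →ₗ[K] Dual K ℓ →ₗ[K] M) (x : ℓ) :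
    ∑ k, (B (adDual x (killingEquiv K ℓ (e k))) (e.coord k) +
      B (killingEquiv K ℓ (e k)) (adDual x (e.coord k))) = 0 := by
  simp only [adDual_killingEquiv, Finset.sum_add_distrib, map_neg, LinearMap.neg_apply,
    Finset.sum_neg_distrib]
  rw [neg_add_eq_zero]
  exact sum_map_lie_coord e (B ∘ₗ (killingEquiv K ℓ).toLinearMap) x

theorem sum_lie_casimir (e : Basis ι K ℓ) (B : ℓ →ₗ[K] ℓ →ₗ[K] M) (x : ℓ) :
    ∑ k, (B ⁅x, (killingEquiv K ℓ).symm (e.coord k)⁆ (e k) +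
      B ((killingEquiv K ℓ).symm (e.coord k)) ⁅x, e k⁆) = 0 := by
  simp only [lie_killingEquiv_symm, Finset.sum_add_distrib, map_neg, LinearMap.neg_apply,
    Finset.sum_neg_distrib]
  rw [neg_add_eq_zero]
  exact (sum_map_lie_coord e (B ∘ₗ (killingEquiv K ℓ).symm.toLinearMap).flip x).symm

/-- The coefficients of the Casimir tensor in the basis `e` are the Killing products of the `y k`,
hence symmetric. -/
theorem sum_casimir_comm (e : Basis ι K ℓ) (B : ℓ →ₗ[K] ℓ →ₗ[K] M) :
    ∑ k, B ((killingEquiv K ℓ).symm (e.coord k)) (e k) =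
      ∑ k, B (e k) ((killingEquiv K ℓ).symm (e.coord k)) := by
  set y : ι → ℓ := fun k => (killingEquiv K ℓ).symm (e.coord k) with hy
  have hc : ∀ k z, e.coord k z = killingEquiv K ℓ (y k) z := fun k z => by
    rw [hy]; simp only [LinearEquiv.apply_symm_apply]
  have h1 : ∀ k, B (y k) (e k) = ∑ l, e.coord l (y k) • B (e l) (e k) := fun k =>
    (sum_coord_smul_map e (B.flip (e k)) (y k)).symm
  have h2 : ∀ k, B (e k) (y k) = ∑ l, e.coord l (y k) • B (e k) (e l) := fun k =>
    (sum_coord_smul_map e (B (e k)) (y k)).symm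
  change ∑ k, B (y k) (e k) = ∑ k, B (e k) (y k)
  simp only [h1, h2]
  rw [Finset.sum_comm]
  refine Finset.sum_congr rfl fun l _ => Finset.sum_congr rfl fun k _ => ?_
  rw [hc, hc, killingEquiv_comm]

theorem sum_lie_casimir_self (e : Basis ι K ℓ) :
    ∑ k, ⁅e k, (killingEquiv K ℓ).symm (e.coord k)⁆ = 0 := by
  have h := sum_casimir_comm e (LieModule.toEnd K ℓ ℓ : ℓ →ₗ[K] ℓ →ₗ[K] ℓ)
  have h' : ∑ k, ⁅(killingEquiv K ℓ).symm (e.coord k), e k⁆ =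
      ∑ k, ⁅e k, (killingEquiv K ℓ).symm (e.coord k)⁆ := h
  rw [← sub_eq_zero, ← Finset.sum_sub_distrib] at h'
  have h2 : (2 : K) • ∑ k, ⁅e k, (killingEquiv K ℓ).symm (e.coord k)⁆ = 0 := by
    rw [← neg_eq_zero, ← h', two_smul, ← Finset.sum_add_distrib, ← Finset.sum_neg_distrib]
    refine Finset.sum_congr rfl fun k _ => ?_
    rw [← lie_skew]
    abel
  exact (smul_eq_zero.1 h2).resolve_left two_ne_zero

/-- For symmetric `B` the two halves of the invariance identity `sum_lie_casimir` are equal, by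
symmetry of the Casimir tensor; so twice this sum is zero. -/
theorem sum_casimir_lie_of_symm (e : Basis ι K ℓ) (B : ℓ →ₗ[K] ℓ →ₗ[K] M)
    (hB : ∀ x y, B x y = B y x) (x : ℓ) :
    ∑ k, B ⁅x, e k⁆ ((killingEquiv K ℓ).symm (e.coord k)) = 0 := by
  have h := sum_lie_casimir e B x
  have h' := sum_casimir_comm e (B ∘ₗ (LieAlgebra.ad K ℓ x : ℓ →ₗ[K] ℓ))
  simp only [LinearMap.comp_apply, LieAlgebra.ad_apply] at h'
  rw [Finset.sum_add_distrib, h'] at h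
  simp only [hB _ ⁅x, _⁆] at h
  rw [← two_smul K] at h
  exact (smul_eq_zero.1 h).resolve_left two_ne_zero

end Invariance

/-! ### Action of `θ(x_0)` and of `Q` on quadratic states. -/

section States

variable {K : Type*} [Field K] {ℓ : Type*} [LieRing ℓ] [LieAlgebra K ℓ]
  {ι : Type*} [Fintype ι]

attribute [local simp] normalOrder Mode.isCre Mode.isOdd isOddList

/-- The exceptions are the possible contractions: `β_0` with `γ_0` at `m = 0` and `b_1` with
`c_{-1}` at `m = 1`. -/
theorem thetaTerm_gamma_c (e : Basis ι K ℓ) (x : ℓ) (f g : Dual K ℓ) {m : ℤ}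
    (hm : m ∉ ({0, 1} : Finset ℤ)) :
    thetaTerm e x 0 m (opGamma 0 f (opC (-1) g (vac K ℓ))) = 0 := by
  simp only [Finset.mem_insert, Finset.mem_singleton, not_or] at hm
  obtain ⟨h0, h1⟩ := hm
  unfold thetaTerm
  simp only [LinearMap.add_apply, LinearMap.sum_apply, zero_add]
  rw [Finset.sum_eq_zero fun v _ => ?_, Finset.sum_eq_zero fun v _ => ?_, add_zero]
  all_goals refine normalOrder_apply_eq_zero _ _ ?_
  all_goals rcases (show 1 ≤ m ∨ 1 ≤ -m by omega) with h | h
  · exact ⟨_, .head _, by simp; omega, by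
      simp [show (0 : ℤ) ≤ m by omega, show m + -1 ≠ 0 by omega]⟩
  · exact ⟨_, .tail _ (.head _), by simp; omega, by simp [h]⟩
  · exact ⟨_, .head _, by simp; omega, by
      simp [show (0 : ℤ) ≤ m by omega, show m ≠ 0 by omega]⟩
  · exact ⟨_, .tail _ (.head _), by simp; omega, by
      rw [op_gamma, gamma_gamma h le_rfl]; simp [h]⟩

theorem theta_gamma_c (e : Basis ι K ℓ) (x : ℓ) (f g : Dual K ℓ) :
    theta e x 0 (opGamma 0 f (opC (-1) g (vac K ℓ))) =
      -(opGamma 0 (adDual x f) (opC (-1) g (vac K ℓ)) +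
        opGamma 0 f (opC (-1) (adDual x g) (vac K ℓ))) := by
  rw [theta, opSum_apply_eq_sum _ _ {0, 1} fun m hm => thetaTerm_gamma_c e x f g hm]
  rw [Finset.sum_insert (by decide), Finset.sum_singleton]
  simp [thetaTerm]
  have h1 := sum_lie_smul_map_coord e
    (LinearMap.applyₗ (opC (-1) g (vac K ℓ)) ∘ₗ opGamma (K := K) (ℓ := ℓ) 0) f x
  have h2 := sum_lie_smul_map_coord e
    (opGamma 0 f ∘ₗ LinearMap.applyₗ (vac K ℓ) ∘ₗ opC (K := K) (ℓ := ℓ) (-1)) g x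
  simp only [LinearMap.comp_apply, LinearMap.applyₗ_apply_apply] at h1 h2
  rw [h1, h2, add_comm]

theorem thetaTerm_beta_b (e : Basis ι K ℓ) (x y z : ℓ) {m : ℤ}
    (hm : m ∉ ({-1} : Finset ℤ)) :
    thetaTerm e x 0 m (opBeta (-1) y (opB (-1) z (vac K ℓ))) = 0 := by
  simp only [Finset.mem_singleton] at hm
  unfold thetaTerm
  simp only [LinearMap.add_apply, LinearMap.sum_apply, zero_add]
  rw [Finset.sum_eq_zero fun v _ => ?_, Finset.sum_eq_zero fun v _ => ?_, add_zero]
  all_goals refine normalOrder_apply_eq_zero _ _ ?_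
  all_goals rcases (show 0 ≤ m ∨ 2 ≤ -m by omega) with h | h
  · exact ⟨_, .head _, by simp; omega, by simp [h]⟩
  · exact ⟨_, .tail _ (.head _), by simp; omega, by
      simp [show (1 : ℤ) ≤ -m by omega, show -m + -1 ≠ 0 by omega]⟩
  · exact ⟨_, .head _, by simp; omega, by simp [h]⟩
  · exact ⟨_, .tail _ (.head _), by simp; omega, by
      simp [show (1 : ℤ) ≤ -m by omega, show -m + -1 ≠ 0 by omega]⟩

theorem theta_beta_b (e : Basis ι K ℓ) (x y z : ℓ) :
    theta e x 0 (opBeta (-1) y (opB (-1) z (vac K ℓ))) =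
      opBeta (-1) ⁅x, y⁆ (opB (-1) z (vac K ℓ)) + opBeta (-1) y (opB (-1) ⁅x, z⁆ (vac K ℓ)) := by
  rw [theta, opSum_apply_eq_sum _ _ {-1} fun m hm => thetaTerm_beta_b e x y z hm,
    Finset.sum_singleton]
  simp [thetaTerm]
  have h1 := sum_repr_smul_map_lie e (LinearMap.applyₗ (opB (-1) z (vac K ℓ)) ∘ₗ
    opBeta (K := K) (ℓ := ℓ) (-1)) x y
  have h2 := sum_repr_smul_map_lie e (opBeta (-1) y ∘ₗ LinearMap.applyₗ (vac K ℓ) ∘ₗ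
    opB (K := K) (ℓ := ℓ) (-1)) x z
  simp only [LinearMap.comp_apply, LinearMap.applyₗ_apply_apply] at h1 h2
  rw [h1, h2]

/-- At `(0, 0)` the term `β_0 γ_0 c_0` contracts with `γ_0`; at `(0, 1)` and `(1, 0)` the operator
`b_1` contracts with `c_{-1}`. -/
theorem QTerm_gamma_c (e : Basis ι K ℓ) (f g : Dual K ℓ) {p : ℤ × ℤ}
    (hp : p ∉ ({(0, 0), (0, 1), (1, 0)} : Finset (ℤ × ℤ))) :
    QTerm e p (opGamma 0 f (opC (-1) g (vac K ℓ))) = 0 := by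
  obtain ⟨i, j⟩ := p
  simp only [Finset.mem_insert, Finset.mem_singleton, not_or, Prod.mk.injEq] at hp
  unfold QTerm
  simp only [LinearMap.add_apply, LinearMap.smul_apply, LinearMap.sum_apply]
  rw [Finset.sum_eq_zero fun u _ => Finset.sum_eq_zero fun v _ => ?_,
    Finset.sum_eq_zero fun u _ => Finset.sum_eq_zero fun v _ => ?_, smul_zero, add_zero]
  all_goals refine normalOrder_apply_eq_zero _ _ ?_
  all_goals rcases (show 2 ≤ i + j ∨ 1 ≤ -i ∨ 1 ≤ -j by omega) with h | h | h
  · exact ⟨_, .head _, by simp; omega, by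
      simp [show (0 : ℤ) ≤ i + j by omega, show i + j + -1 ≠ 0 by omega]⟩
  · exact ⟨_, .tail _ (.head _), by simp; omega, by simp [h]⟩
  · exact ⟨_, .tail _ (.tail _ (.head _)), by simp; omega, by simp [h]⟩
  · exact ⟨_, .head _, by simp; omega, by
      simp [show (0 : ℤ) ≤ i + j by omega, show i + j ≠ 0 by omega]⟩
  · exact ⟨_, .tail _ (.head _), by simp; omega, by
      rw [op_gamma, gamma_gamma h le_rfl]; simp [h]⟩
  · exact ⟨_, .tail _ (.tail _ (.head _)), by simp; omega, by simp [h]⟩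

/-- By `theta_gamma_c` the right side is `∑ c_0^{u'} θ(u_0)` applied to the state, so closedness of
`r` reduces to its invariance. -/
theorem Q_gamma_c [CharZero K] (e : Basis ι K ℓ) (f g : Dual K ℓ) :
    Q e (opGamma 0 f (opC (-1) g (vac K ℓ))) =
      -∑ u, opC 0 (e.coord u) (opGamma 0 (adDual (e u) f) (opC (-1) g (vac K ℓ)) +
        opGamma 0 f (opC (-1) (adDual (e u) g) (vac K ℓ))) := by
  rw [Q, opSum_apply_eq_sum _ _ _ fun m hm => QTerm_gamma_c e f g hm]
  rw [Finset.sum_insert (by decide), Finset.sum_insert (by decide), Finset.sum_singleton]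
  simp [QTerm]
  have h1 := fun u => sum_lie_smul_map_coord e (LinearMap.applyₗ
    (opC 0 (e.coord u) (opC (-1) g (vac K ℓ))) ∘ₗ opGamma (K := K) (ℓ := ℓ) 0) f (e u)
  have h2 := fun v => sum_lie_smul_map_coord' e (opGamma 0 f ∘ₗ opC 0 (e.coord v) ∘ₗ
    LinearMap.applyₗ (vac K ℓ) ∘ₗ opC (K := K) (ℓ := ℓ) (-1)) g (e v)
  have h3 := fun u => sum_lie_smul_map_coord e (opGamma 0 f ∘ₗ
    LinearMap.applyₗ (opC 0 (e.coord u) (vac K ℓ)) ∘ₗ opC (K := K) (ℓ := ℓ) (-1)) g (e u)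
  have h4 : ∀ u (f : Dual K ℓ), opC (-1) f (opC 0 (e.coord u) (vac K ℓ)) =
      -opC 0 (e.coord u) (opC (-1) f (vac K ℓ)) := fun u f =>
    op_creation_creation_odd (m := .c (-1) f) (m' := .c 0 (e.coord u)) rfl rfl rfl rfl _
  simp only [LinearMap.comp_apply, LinearMap.applyₗ_apply_apply] at h1 h2 h3
  -- Exchanging `u` and `v` turns one of the two `b c c` contributions into the other, and their
  -- factors `1/2` add up to `1`.
  rw [Finset.sum_comm (f := fun u v => g ⁅e u, e v⁆ •
    opGamma 0 f (opC 0 (e.coord v) (opC (-1) (e.coord u) (vac K ℓ))))]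
  simp only [h1, h2, h3]
  simp only [h4, map_neg, Finset.sum_neg_distrib, Finset.sum_add_distrib]
  module

theorem QTerm_beta_b (e : Basis ι K ℓ) (y z : ℓ) {p : ℤ × ℤ}
    (hp : p ∉ ({(-1, -1), (-1, 0), (0, -1)} : Finset (ℤ × ℤ))) :
    QTerm e p (opBeta (-1) y (opB (-1) z (vac K ℓ))) = 0 := by
  obtain ⟨i, j⟩ := p
  simp only [Finset.mem_insert, Finset.mem_singleton, not_or, Prod.mk.injEq] at hp
  unfold QTerm
  simp only [LinearMap.add_apply, LinearMap.smul_apply, LinearMap.sum_apply]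
  rw [Finset.sum_eq_zero fun u _ => Finset.sum_eq_zero fun v _ => ?_,
    Finset.sum_eq_zero fun u _ => Finset.sum_eq_zero fun v _ => ?_, smul_zero, add_zero]
  all_goals refine normalOrder_apply_eq_zero _ _ ?_
  all_goals rcases (show 0 ≤ i + j ∨ 2 ≤ -i ∨ 2 ≤ -j by omega) with h | h | h
  · exact ⟨_, .head _, by simp; omega, by simp [h]⟩
  · exact ⟨_, .tail _ (.head _), by simp; omega, by
      simp [show (1 : ℤ) ≤ -i by omega, show -i + -1 ≠ 0 by omega]⟩
  · exact ⟨_, .tail _ (.tail _ (.head _)), by simp; omega, by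
      simp [show (1 : ℤ) ≤ -j by omega, show -j + -1 ≠ 0 by omega]⟩
  · exact ⟨_, .head _, by simp; omega, by simp [h]⟩
  · exact ⟨_, .tail _ (.head _), by simp; omega, by
      simp [show (1 : ℤ) ≤ -i by omega, show -i + -1 ≠ 0 by omega]⟩
  · exact ⟨_, .tail _ (.tail _ (.head _)), by simp; omega, by
      simp [show (1 : ℤ) ≤ -j by omega, show -j + -1 ≠ 0 by omega]⟩

/-- The middle sum is `∑ c_0^{u'} θ(u_0)` applied to the state. The `β_{-2}` term is the double
contraction by `β_{-2} γ_1 c_1`; the last sum comes from `β_{-1} γ_0 c_1`, where only `b_{-1}` is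
contracted. -/
theorem Q_beta_b [CharZero K] (e : Basis ι K ℓ) (y z : ℓ) :
    Q e (opBeta (-1) y (opB (-1) z (vac K ℓ))) = opBeta (-2) ⁅z, y⁆ (vac K ℓ) +
      ∑ u, opC 0 (e.coord u) (opBeta (-1) ⁅e u, y⁆ (opB (-1) z (vac K ℓ)) +
        opBeta (-1) y (opB (-1) ⁅e u, z⁆ (vac K ℓ))) -
      ∑ u, opGamma 0 (e.coord u) (opBeta (-1) ⁅e u, z⁆ (opBeta (-1) y (vac K ℓ))) := by
  rw [Q, opSum_apply_eq_sum _ _ _ fun m hm => QTerm_beta_b e y z hm]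
  rw [Finset.sum_insert (by decide), Finset.sum_insert (by decide), Finset.sum_singleton]
  simp [QTerm]
  have h1 := fun u (w : W K ℓ) => sum_repr_smul_map_lie e (LinearMap.applyₗ w ∘ₗ
    opBeta (K := K) (ℓ := ℓ) (-1)) (e u) y
  have h2 := fun v (w : W K ℓ) => sum_repr_smul_map_lie' e (LinearMap.applyₗ w ∘ₗ
    opBeta (K := K) (ℓ := ℓ) (-1)) (e v) z
  have h3 := fun u (w : W K ℓ) => sum_repr_smul_map_lie e (opBeta (-1) y ∘ₗ
    LinearMap.applyₗ w ∘ₗ opB (K := K) (ℓ := ℓ) (-1)) (e u) z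
  have h4 := fun v (w : W K ℓ) => sum_repr_smul_map_lie' e (opBeta (-1) y ∘ₗ
    LinearMap.applyₗ w ∘ₗ opB (K := K) (ℓ := ℓ) (-1)) (e v) z
  have h5 := fun u => sum_repr_smul_map_lie e (LinearMap.applyₗ (vac K ℓ) ∘ₗ
    opBeta (K := K) (ℓ := ℓ) (-2)) (e u) y
  have h6 := sum_repr_smul_map_lie' e (LinearMap.applyₗ (vac K ℓ) ∘ₗ
    opBeta (K := K) (ℓ := ℓ) (-2)) y z
  have h7 : ∀ u (x : ℓ), opB (-1) x (opC 0 (e.coord u) (vac K ℓ)) =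
      -opC 0 (e.coord u) (opB (-1) x (vac K ℓ)) := fun u x =>
    op_creation_creation_odd (m := .b (-1) x) (m' := .c 0 (e.coord u)) rfl rfl rfl rfl _
  have h8 : ∀ u (x : ℓ) (w : W K ℓ), opBeta (-1) x (opGamma 0 (e.coord u) w) =
      opGamma 0 (e.coord u) (opBeta (-1) x w) := fun u x =>
    op_creation_creation_even (m := .beta (-1) x) (m' := .gamma 0 (e.coord u)) rfl rfl rfl rfl
  simp only [LinearMap.comp_apply, LinearMap.applyₗ_apply_apply] at h1 h2 h3 h4 h5 h6
  rw [Finset.sum_comm (f := fun u v => e.repr z u •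
    opBeta (-1) ⁅e u, e v⁆ (opGamma 0 (e.coord v) (opBeta (-1) y (vac K ℓ)))),
    Finset.sum_comm (f := fun u v => e.repr z u •
    opBeta (-1) y (opB (-1) ⁅e u, e v⁆ (opC 0 (e.coord v) (vac K ℓ))))]
  simp only [smul_comm (e.repr y _) (e.repr z _), ← Finset.smul_sum, h1, h2, h3, h4, h5, h6]
  simp only [← lie_skew z (e _), h7, h8, map_neg, LinearMap.neg_apply, neg_neg,
    Finset.sum_neg_distrib, Finset.sum_add_distrib]
  module

end States

/-! ### Coefficients of low monomials in the image of `Q`. -/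

section Functionals

variable {K : Type*} [Field K] {ℓ : Type*} [LieRing ℓ] [LieAlgebra K ℓ]
  {ι : Type*} [Fintype ι]

attribute [local simp] normalOrder Mode.isCre Mode.isOdd isOddList

/-- The functional reads off a coefficient of `β_{-1} b_{-1}`. The three mode indices of a summand
add up to zero: either a `γ` or `c` has index at most `0`, or both are positive and the `β` or `b`
has index at most `-2`. Such a creation operator does not occur in `β_{-1} b_{-1}`. -/
theorem vacCoeff_gamma_c_QTerm (e : Basis ι K ℓ) (f g : Dual K ℓ) (p : ℤ × ℤ) (w : W K ℓ) :
    vacCoeff (opGamma 1 f (opC 1 g (QTerm e p w))) = 0 := by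
  obtain ⟨i, j⟩ := p
  unfold QTerm
  simp only [LinearMap.add_apply, LinearMap.smul_apply, LinearMap.sum_apply, map_add, map_smul,
    map_sum]
  rw [Finset.sum_eq_zero fun u _ => Finset.sum_eq_zero fun v _ => ?_,
    Finset.sum_eq_zero fun u _ => Finset.sum_eq_zero fun v _ => ?_, smul_zero, add_zero]
  all_goals refine comp_normalOrder_eq_zero _ (vacCoeff ∘ₗ opGamma 1 f ∘ₗ opC 1 g) ?_ w
  all_goals rcases (show i + j ≤ -2 ∨ -i ≤ 0 ∨ -j ≤ 0 by omega) with h | h | h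
  · exact ⟨_, .head _, by simp; omega, fun w => by
      simp [show i + j ≤ -1 by omega, show 1 + (i + j) ≠ 0 by omega]⟩
  · exact ⟨_, .tail _ (.head _), by simp; omega, fun w => by simp [h]⟩
  · exact ⟨_, .tail _ (.tail _ (.head _)), by simp; omega, fun w => by simp [h]⟩
  · exact ⟨_, .head _, by simp; omega, fun w => by
      simp [show i + j ≤ -1 by omega, show 1 + (i + j) ≠ 0 by omega]⟩
  · exact ⟨_, .tail _ (.head _), by simp; omega, fun w => by simp [h]⟩
  · exact ⟨_, .tail _ (.tail _ (.head _)), by simp; omega, fun w => by simp [h]⟩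

theorem vacCoeff_gamma_c_Q (e : Basis ι K ℓ) (f g : Dual K ℓ) (w : W K ℓ) :
    vacCoeff (opGamma 1 f (opC 1 g (Q e w))) = 0 :=
  (map_opSum_eq_sum _ (vacCoeff ∘ₗ opGamma 1 f ∘ₗ opC 1 g) w ∅
    fun p _ => vacCoeff_gamma_c_QTerm e f g p w).trans Finset.sum_empty

/-- A summand contributes to the coefficient of `γ_0 c_{-1}` only if it creates nothing but `γ_0`
and `c_{-1}`. This leaves `β_0 γ_1 c_{-1}`, `β_1 γ_0 c_{-1}` and the `b_0 c c` terms with indices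
`±1`. The pair `(1, 1)` is left to the explicit evaluation: its two `c_{-1}` cannot both be
absorbed. -/
theorem vacCoeff_beta_zero_b_one_QTerm (e : Basis ι K ℓ) (y z : ℓ) (w : W K ℓ) {p : ℤ × ℤ}
    (hp : p ∉ ({(-1, 1), (0, 1), (1, -1), (1, 1)} : Finset (ℤ × ℤ))) :
    vacCoeff (opBeta 0 y (opB 1 z (QTerm e p w))) = 0 := by
  obtain ⟨i, j⟩ := p
  simp only [Finset.mem_insert, Finset.mem_singleton, not_or, Prod.mk.injEq] at hp
  unfold QTerm
  simp only [LinearMap.add_apply, LinearMap.smul_apply, LinearMap.sum_apply, map_add, map_smul,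
    map_sum]
  rw [Finset.sum_eq_zero fun u _ => Finset.sum_eq_zero fun v _ => ?_,
    Finset.sum_eq_zero fun u _ => Finset.sum_eq_zero fun v _ => ?_, smul_zero, add_zero]
  all_goals refine comp_normalOrder_eq_zero _ (vacCoeff ∘ₗ opBeta 0 y ∘ₗ opB 1 z) ?_ w
  · rcases (show i + j ≤ -1 ∨ (-i ≤ 0 ∧ i ≠ 1) ∨ (-j ≤ 0 ∧ j ≠ 1) by omega)
      with h | ⟨h, h'⟩ | ⟨h, h'⟩
    · exact ⟨_, .head _, by simp; omega, fun w => by simp [h]⟩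
    · exact ⟨_, .tail _ (.head _), by simp; omega, fun w => by
        simp [h, show 1 + -i ≠ 0 by omega]⟩
    · exact ⟨_, .tail _ (.tail _ (.head _)), by simp; omega, fun w => by
        simp [h, show 1 + -j ≠ 0 by omega]⟩
  · rcases (show i + j ≤ -1 ∨ 1 ≤ i ∨ (-j ≤ 0 ∧ j ≠ 1) by omega) with h | h | ⟨h, h'⟩
    · exact ⟨_, .head _, by simp; omega, fun w => by simp [h]⟩
    · exact ⟨_, .tail _ (.head _), by simp; omega, fun w => by
        simp [show -i ≤ 0 by omega, show i ≠ 0 by omega]⟩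
    · exact ⟨_, .tail _ (.tail _ (.head _)), by simp; omega, fun w => by
        simp [h, show 1 + -j ≠ 0 by omega]⟩

/-- Here only `γ_{-1}` and `c_0` may be created: `β_1 γ_{-1} c_0` and `β_0 γ_{-1} c_1` remain,
besides `b_0 c_0 c_0`, which has one `c_0` too many and evaluates to zero. -/
theorem vacCoeff_beta_one_b_zero_QTerm (e : Basis ι K ℓ) (y z : ℓ) (w : W K ℓ) {p : ℤ × ℤ}
    (hp : p ∉ ({(1, 0), (1, -1), (0, 0)} : Finset (ℤ × ℤ))) :
    vacCoeff (opBeta 1 y (opB 0 z (QTerm e p w))) = 0 := by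
  obtain ⟨i, j⟩ := p
  simp only [Finset.mem_insert, Finset.mem_singleton, not_or, Prod.mk.injEq] at hp
  unfold QTerm
  simp only [LinearMap.add_apply, LinearMap.smul_apply, LinearMap.sum_apply, map_add, map_smul,
    map_sum]
  rw [Finset.sum_eq_zero fun u _ => Finset.sum_eq_zero fun v _ => ?_,
    Finset.sum_eq_zero fun u _ => Finset.sum_eq_zero fun v _ => ?_, smul_zero, add_zero]
  all_goals refine comp_normalOrder_eq_zero _ (vacCoeff ∘ₗ opBeta 1 y ∘ₗ opB 0 z) ?_ w
  · rcases (show i + j ≤ -1 ∨ 1 ≤ i ∨ 1 ≤ j by omega) with h | h | h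
    · exact ⟨_, .head _, by simp; omega, fun w => by simp [h]⟩
    · exact ⟨_, .tail _ (.head _), by simp; omega, fun w => by
        simp [show -i ≤ 0 by omega, show i ≠ 0 by omega]⟩
    · exact ⟨_, .tail _ (.tail _ (.head _)), by simp; omega, fun w => by
        simp [show -j ≤ 0 by omega, show j ≠ 0 by omega]⟩
  · rcases (show i + j ≤ -1 ∨ (-i ≤ 0 ∧ i ≠ 1) ∨ 1 ≤ j by omega) with h | ⟨h, h'⟩ | h
    · exact ⟨_, .head _, by simp; omega, fun w => by simp [h]⟩
    · exact ⟨_, .tail _ (.head _), by simp; omega, fun w => by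
        simp [h, show 1 + -i ≠ 0 by omega]⟩
    · exact ⟨_, .tail _ (.tail _ (.head _)), by simp; omega, fun w => by
        simp [show -j ≤ 0 by omega, show j ≠ 0 by omega]⟩

theorem vacCoeff_beta_zero_b_one_Q [CharZero K] (e : Basis ι K ℓ) (y z : ℓ) (w : W K ℓ) :
    vacCoeff (opBeta 0 y (opB 1 z (Q e w))) =
      -∑ v, vacCoeff (opGamma 1 (e.coord v) (opBeta 0 ⁅e v, z⁆ (opBeta 0 y w))) +
        ∑ v, vacCoeff (opBeta 0 y (opC 1 (e.coord v) (opB 0 ⁅e v, z⁆ w))) -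
        vacCoeff (opBeta 1 ⁅z, y⁆ w) := by
  refine (map_opSum_eq_sum _ (vacCoeff ∘ₗ opBeta 0 y ∘ₗ opB 1 z) w _
    fun p hp => vacCoeff_beta_zero_b_one_QTerm e y z w hp).trans ?_
  rw [Finset.sum_insert (by decide), Finset.sum_insert (by decide), Finset.sum_insert (by decide), Finset.sum_singleton]
  simp only [QTerm, normalOrder, Mode.isCre, Mode.isOdd, isOddList, op_beta, op_gamma, op_b, op_c,
    Int.reduceNeg, Int.reduceAdd, neg_neg, neg_zero, zero_add, Int.reduceLE,
    decide_true, decide_false, if_true, if_false, Bool.xor_false, Bool.xor_true, Bool.not_true,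
    Bool.not_false, Bool.and_true, Bool.and_false, Bool.false_eq_true, mul_one, one_mul]
  simp only [LinearMap.comp_apply, LinearMap.add_apply, LinearMap.smul_apply, LinearMap.neg_apply,
    LinearMap.sum_apply, End.mul_apply, map_add, map_sub, map_neg, map_smul, map_sum,
    beta_gamma, b_c, b_beta, b_gamma, c_beta, beta_c, vacCoeff_c, vacCoeff_gamma, Int.reduceLE, Int.reduceNeg,
    Int.reduceAdd, Int.reduceEq, le_refl, or_true, or_false, if_true, if_false,
    zero_smul, one_div, smul_eq_mul, mul_zero, mul_neg, neg_zero, add_zero, zero_add,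
    sub_zero, zero_sub, Basis.coord_apply, Finset.sum_const_zero, Finset.sum_neg_distrib]
  have h1 := fun v => sum_repr_smul_map_lie' e (vacCoeff ∘ₗ opBeta 0 y ∘ₗ opGamma 1 (e.coord v) ∘ₗ
    LinearMap.applyₗ w ∘ₗ opBeta (K := K) (ℓ := ℓ) 0) (e v) z
  have h2 := fun v => sum_repr_smul_map_lie' e (vacCoeff ∘ₗ opBeta 0 y ∘ₗ opC 1 (e.coord v) ∘ₗ
    LinearMap.applyₗ w ∘ₗ opB (K := K) (ℓ := ℓ) 0) (e v) z
  have h3 := fun u => sum_repr_smul_map_lie e (vacCoeff ∘ₗ opBeta 0 y ∘ₗ opC 1 (e.coord u) ∘ₗ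
    LinearMap.applyₗ w ∘ₗ opB (K := K) (ℓ := ℓ) 0) (e u) z
  have h4 := fun u => sum_repr_smul_map_lie e (vacCoeff ∘ₗ
    LinearMap.applyₗ w ∘ₗ opBeta (K := K) (ℓ := ℓ) 1) (e u) y
  have h5 := sum_repr_smul_map_lie' e (vacCoeff ∘ₗ
    LinearMap.applyₗ w ∘ₗ opBeta (K := K) (ℓ := ℓ) 1) y z
  have h6 : ∀ (v : ι) (x : ℓ), opBeta 0 y (opGamma 1 (e.coord v) (opBeta 0 x w)) =
      opGamma 1 (e.coord v) (opBeta 0 x (opBeta 0 y w)) := fun v x => by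
    refine (op_annihilation_even_comm (m := .beta 0 y) (m' := .gamma 1 (e.coord v))
      rfl rfl rfl rfl _).trans (congrArg (opGamma 1 (e.coord v)) ?_)
    exact op_annihilation_even_comm (m := .beta 0 y) (m' := .beta 0 x) rfl rfl rfl rfl _
  simp only [LinearMap.comp_apply, LinearMap.applyₗ_apply_apply, smul_eq_mul] at h1 h2 h3 h4 h5
  rw [Finset.sum_comm (f := fun u v => e.repr z u *
      vacCoeff (opBeta 0 y (opGamma 1 (e.coord v) (opBeta 0 ⁅e u, e v⁆ w)))),
    Finset.sum_comm (f := fun u v => e.repr z u *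
      vacCoeff (opBeta 0 y (opC 1 (e.coord v) (opB 0 ⁅e u, e v⁆ w))))]
  simp only [← Finset.mul_sum, h1, h2, h3, h4, h5]
  simp only [h6, ← lie_skew z (e _), map_neg, LinearMap.neg_apply, Finset.sum_neg_distrib]
  ring

theorem vacCoeff_beta_one_b_zero_Q (e : Basis ι K ℓ) (y z : ℓ) (w : W K ℓ) :
    vacCoeff (opBeta 1 y (opB 0 z (Q e w))) =
      ∑ v, vacCoeff (opBeta 0 ⁅e v, y⁆ (opC 1 (e.coord v) (opB 0 z w))) -
        vacCoeff (opBeta 1 ⁅z, y⁆ w) := by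
  refine (map_opSum_eq_sum _ (vacCoeff ∘ₗ opBeta 1 y ∘ₗ opB 0 z) w _
    fun p hp => vacCoeff_beta_one_b_zero_QTerm e y z w hp).trans ?_
  rw [Finset.sum_insert (by decide), Finset.sum_insert (by decide), Finset.sum_singleton]
  simp only [QTerm, normalOrder, Mode.isCre, Mode.isOdd, isOddList, op_beta, op_gamma, op_b, op_c,
    Int.reduceNeg, Int.reduceAdd, neg_neg, neg_zero, add_zero, Int.reduceLE,
    decide_true, decide_false, if_true, if_false, Bool.xor_false, Bool.xor_true, Bool.not_true,
    Bool.not_false, Bool.and_true, Bool.and_false, Bool.false_eq_true, mul_one, one_mul]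
  simp only [LinearMap.comp_apply, LinearMap.add_apply, LinearMap.smul_apply,
    LinearMap.sum_apply, End.mul_apply, map_add, map_sub, map_neg, map_smul, map_sum,
    beta_gamma, b_c, b_beta, b_gamma, c_beta, beta_c, vacCoeff_c, vacCoeff_gamma, Int.reduceLE, Int.reduceNeg,
    Int.reduceAdd, Int.reduceEq, le_refl, or_true, or_false, if_true, if_false,
    zero_smul, one_div, smul_eq_mul, mul_zero, mul_neg, neg_zero, add_zero, zero_add,
    sub_zero, zero_sub, Basis.coord_apply, Finset.sum_const_zero, Finset.sum_neg_distrib]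
  have h1 := fun u (w : W K ℓ) => sum_repr_smul_map_lie e (vacCoeff ∘ₗ
    LinearMap.applyₗ w ∘ₗ opBeta (K := K) (ℓ := ℓ) 0) (e u) y
  have h4 := fun u => sum_repr_smul_map_lie e (vacCoeff ∘ₗ
    LinearMap.applyₗ w ∘ₗ opBeta (K := K) (ℓ := ℓ) 1) (e u) y
  have h5 := sum_repr_smul_map_lie' e (vacCoeff ∘ₗ
    LinearMap.applyₗ w ∘ₗ opBeta (K := K) (ℓ := ℓ) 1) y z
  have h6 : ∀ v : ι, opB 0 z (opC 1 (e.coord v) w) = -opC 1 (e.coord v) (opB 0 z w) := fun v =>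
    op_annihilation_odd_comm (m := .b 0 z) (m' := .c 1 (e.coord v)) rfl rfl rfl rfl _
  simp only [LinearMap.comp_apply, LinearMap.applyₗ_apply_apply, smul_eq_mul] at h1 h4 h5
  simp only [← Finset.mul_sum, h1, h4, h5, h6]
  simp only [map_neg, Finset.sum_neg_distrib]
  ring

end Functionals

theorem representsNontrivialClass_of_functional {K M : Type*} [Field K] [AddCommGroup M]
    [Module K M] {D : End K M} {w : M} (hw : D w = 0) (η : M →ₗ[K] K) (hη : ∀ v, η (D v) = 0)
    (h : η w ≠ 0) : RepresentsNontrivialClass D w := by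
  refine ⟨hw, fun h0 => h ?_⟩
  rw [Submodule.Quotient.mk_eq_zero] at h0
  obtain ⟨v, rfl⟩ : w ∈ LinearMap.range D := h0
  exact hη v

/-! ### Invariance, closedness and nontriviality of the two classes. -/

section Classes

variable {K : Type*} [Field K] [CharZero K] {ℓ : Type*} [LieRing ℓ] [LieAlgebra K ℓ]
  [FiniteDimensional K ℓ] [LieAlgebra.IsSemisimple K ℓ] {ι : Type*} [Fintype ι]

theorem rState_eq (e : Basis ι K ℓ) : rState e =
    ∑ k, opGamma 0 (killingEquiv K ℓ (e k)) (opC (-1) (e.coord k) (vac K ℓ)) := rfl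

theorem tState_eq (e : Basis ι K ℓ) : tState e =
    ∑ k, opBeta (-1) ((killingEquiv K ℓ).symm (e.coord k)) (opB (-1) (e k) (vac K ℓ)) := rfl

/-- The bilinear map `(a, b) ↦ η (S a (T b))`. -/
def opBilin {A B M : Type*} [AddCommGroup A] [Module K A] [AddCommGroup B] [Module K B]
    [AddCommGroup M] [Module K M] (η : W K ℓ →ₗ[K] M) (S : A →ₗ[K] End K (W K ℓ))
    (T : B →ₗ[K] W K ℓ) : A →ₗ[K] B →ₗ[K] M :=
  LinearMap.mk₂ K (fun a b => η (S a (T b)))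
    (fun _ _ _ => by simp only [map_add, LinearMap.add_apply])
    (fun _ _ _ => by simp only [map_smul, LinearMap.smul_apply])
    (fun _ _ _ => by simp only [map_add])
    (fun _ _ _ => by simp only [map_smul])

theorem sum_adDual_gamma_c (e : Basis ι K ℓ) (x : ℓ) :
    ∑ k, (opGamma 0 (adDual x (killingEquiv K ℓ (e k))) (opC (-1) (e.coord k) (vac K ℓ)) +
      opGamma 0 (killingEquiv K ℓ (e k)) (opC (-1) (adDual x (e.coord k)) (vac K ℓ))) = 0 := by
  have h := sum_adDual_killing e (opBilin (LinearMap.id : W K ℓ →ₗ[K] W K ℓ) (opGamma 0)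
    (LinearMap.applyₗ (vac K ℓ) ∘ₗ opC (-1))) x
  simp only [opBilin, LinearMap.mk₂_apply, LinearMap.id_apply, LinearMap.comp_apply,
    LinearMap.applyₗ_apply_apply] at h
  exact h

theorem sum_lie_beta_b (e : Basis ι K ℓ) (x : ℓ) :
    ∑ k, (opBeta (-1) ⁅x, (killingEquiv K ℓ).symm (e.coord k)⁆ (opB (-1) (e k) (vac K ℓ)) +
      opBeta (-1) ((killingEquiv K ℓ).symm (e.coord k)) (opB (-1) ⁅x, e k⁆ (vac K ℓ))) = 0 := by
  have h := sum_lie_casimir e (opBilin (LinearMap.id : W K ℓ →ₗ[K] W K ℓ) (opBeta (-1))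
    (LinearMap.applyₗ (vac K ℓ) ∘ₗ opB (-1))) x
  simp only [opBilin, LinearMap.mk₂_apply, LinearMap.id_apply, LinearMap.comp_apply,
    LinearMap.applyₗ_apply_apply] at h
  exact h

theorem rState_mem_invariants (e : Basis ι K ℓ) : rState e ∈ invariants e := by
  refine (Submodule.mem_iInf _).2 fun x => ?_
  rw [LinearMap.mem_ker, rState_eq, map_sum]
  simp only [theta_gamma_c, Finset.sum_neg_distrib, sum_adDual_gamma_c, neg_zero]

theorem tState_mem_invariants (e : Basis ι K ℓ) : tState e ∈ invariants e := by
  refine (Submodule.mem_iInf _).2 fun x => ?_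
  rw [LinearMap.mem_ker, tState_eq, map_sum]
  simp only [theta_beta_b, sum_lie_beta_b]

theorem Q_rState (e : Basis ι K ℓ) : Q e (rState e) = 0 := by
  rw [rState_eq, map_sum]
  simp only [Q_gamma_c, Finset.sum_neg_distrib]
  rw [Finset.sum_comm]
  simp only [← map_sum, sum_adDual_gamma_c, map_zero, Finset.sum_const_zero, neg_zero]

theorem Q_tState (e : Basis ι K ℓ) : Q e (tState e) = 0 := by
  rw [tState_eq, map_sum]
  simp only [Q_beta_b, Finset.sum_add_distrib, Finset.sum_sub_distrib]
  have h1 : ∑ k, opBeta (-2) ⁅e k, (killingEquiv K ℓ).symm (e.coord k)⁆ (vac K ℓ) = 0 := by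
    rw [← LinearMap.sum_apply, ← map_sum, sum_lie_casimir_self, map_zero, LinearMap.zero_apply]
  have h2 : ∀ u, ∑ k, opBeta (-1) ⁅e u, e k⁆
      (opBeta (-1) ((killingEquiv K ℓ).symm (e.coord k)) (vac K ℓ)) = 0 := fun u => by
    have h := sum_casimir_lie_of_symm e (opBilin (LinearMap.id : W K ℓ →ₗ[K] W K ℓ) (opBeta (-1))
      (LinearMap.applyₗ (vac K ℓ) ∘ₗ opBeta (-1))) ?_ (e u)
    · simp only [opBilin, LinearMap.mk₂_apply, LinearMap.id_apply, LinearMap.comp_apply,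
        LinearMap.applyₗ_apply_apply] at h
      exact h
    · intro x y
      simp only [opBilin, LinearMap.mk₂_apply, LinearMap.id_apply, LinearMap.comp_apply,
        LinearMap.applyₗ_apply_apply]
      exact op_creation_creation_even (m := .beta (-1) x) (m' := .beta (-1) y) rfl rfl rfl rfl _
  rw [h1, Finset.sum_comm, Finset.sum_comm (f := fun k u => opGamma 0 (e.coord u) _)]
  simp only [← map_sum, sum_lie_beta_b, h2, map_zero, Finset.sum_const_zero, add_zero, sub_zero]

theorem tState_representsNontrivialClass [Nontrivial ℓ] (e : Basis ι K ℓ) :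
    RepresentsNontrivialClass (Q e) (tState e) := by
  classical
  obtain ⟨i⟩ := e.index_nonempty
  -- The functional chosen below takes the value `f (φ⁻¹(e.coord i))` on `t`, so `f` has to detect
  -- this vector.
  have hne : (killingEquiv K ℓ).symm (e.coord i) ≠ 0 := by
    rw [Ne, LinearEquiv.map_eq_zero_iff]
    intro h
    simpa using LinearMap.congr_fun h (e i)
  obtain ⟨f, hf⟩ : ∃ f : Dual K ℓ, f ((killingEquiv K ℓ).symm (e.coord i)) ≠ 0 := by
    by_contra! h
    exact hne ((forall_dual_apply_eq_zero_iff K _).1 h)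
  refine representsNontrivialClass_of_functional (Q_tState e)
    (vacCoeff ∘ₗ opGamma 1 f ∘ₗ opC 1 (e.coord i)) (fun w => vacCoeff_gamma_c_Q e f _ w) ?_
  rw [tState_eq]
  simpa [Finsupp.single_apply, apply_ite vacCoeff] using hf

/-- The coefficient functional dual to the state `r`. -/
def rDual (e : Basis ι K ℓ) : W K ℓ →ₗ[K] K :=
  ∑ k, (vacCoeff ∘ₗ opBeta 0 ((killingEquiv K ℓ).symm (e.coord k)) ∘ₗ opB 1 (e k) +
    vacCoeff ∘ₗ opBeta 1 ((killingEquiv K ℓ).symm (e.coord k)) ∘ₗ opB 0 (e k))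

/-- The `β_1` terms vanish by `sum_lie_casimir_self` and the `γ_1 β_0 β_0` term by symmetry in the
two `β_0`'s. The `β_0 c_1 b_0` terms of the two halves of `rDual` cancel each other by invariance;
this is why the `γ_{-1} c_0` half is included, although it is zero on `r`. -/
theorem rDual_Q (e : Basis ι K ℓ) (w : W K ℓ) : rDual e (Q e w) = 0 := by
  simp only [rDual, LinearMap.sum_apply, LinearMap.add_apply, LinearMap.comp_apply,
    vacCoeff_beta_zero_b_one_Q, vacCoeff_beta_one_b_zero_Q, Finset.sum_add_distrib,
    Finset.sum_sub_distrib, Finset.sum_neg_distrib]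
  have h1 : ∑ k, vacCoeff (opBeta 1 ⁅e k, (killingEquiv K ℓ).symm (e.coord k)⁆ w) = 0 := by
    rw [← map_sum, ← LinearMap.sum_apply, ← map_sum, sum_lie_casimir_self, map_zero,
      LinearMap.zero_apply, map_zero]
  have h2 : ∀ u, ∑ k, vacCoeff (opGamma 1 (e.coord u) (opBeta 0 ⁅e u, e k⁆
      (opBeta 0 ((killingEquiv K ℓ).symm (e.coord k)) w))) = 0 := fun u =>
    sum_casimir_lie_of_symm e
      (opBilin (vacCoeff ∘ₗ opGamma 1 (e.coord u)) (opBeta 0) (LinearMap.applyₗ w ∘ₗ opBeta 0))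
      (fun x y => congrArg (vacCoeff ∘ₗ opGamma 1 (e.coord u))
        (op_annihilation_even_comm (m := .beta 0 x) (m' := .beta 0 y) rfl rfl rfl rfl _)) (e u)
  have h3 : ∀ u, ∑ k, (vacCoeff (opBeta 0 ⁅e u, (killingEquiv K ℓ).symm (e.coord k)⁆
      (opC 1 (e.coord u) (opB 0 (e k) w))) +
      vacCoeff (opBeta 0 ((killingEquiv K ℓ).symm (e.coord k))
      (opC 1 (e.coord u) (opB 0 ⁅e u, e k⁆ w)))) = 0 := fun u =>
    sum_lie_casimir e
      (opBilin vacCoeff (opBeta 0) (opC 1 (e.coord u) ∘ₗ LinearMap.applyₗ w ∘ₗ opB 0)) (e u)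
  have h4 := Finset.sum_eq_zero fun u (_ : u ∈ Finset.univ) => h3 u
  simp only [Finset.sum_add_distrib] at h4
  rw [h1, Finset.sum_comm, Finset.sum_eq_zero fun u _ => h2 u, Finset.sum_comm,
    Finset.sum_comm (f := fun k u => vacCoeff (opBeta 0 ⁅e u, _⁆ _))]
  linear_combination h4

/-- Each basis vector contributes `-1`, the sign being that of `[β_0, γ_0]`. -/
theorem rDual_rState (e : Basis ι K ℓ) : rDual e (rState e) = -(Fintype.card ι : K) := by
  classical
  have h : ∀ k, killingEquiv K ℓ (e k) ((killingEquiv K ℓ).symm (e.coord k)) = 1 := fun k => by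
    rw [killingEquiv_comm, LinearEquiv.apply_symm_apply]
    simp
  rw [rState_eq]
  simp [rDual, Finsupp.single_apply, apply_ite vacCoeff, h]

theorem rState_representsNontrivialClass [Nontrivial ℓ] (e : Basis ι K ℓ) :
    RepresentsNontrivialClass (Q e) (rState e) := by
  have := e.index_nonempty
  refine representsNontrivialClass_of_functional (Q_rState e) (rDual e) (rDual_Q e) ?_
  rw [rDual_rState, neg_ne_zero, Nat.cast_ne_zero]
  exact Fintype.card_ne_zero

end Classes

end VOWA

end

theorem theorem3 {K : Type*} [Field K] [IsAlgClosed K] [CharZero K]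
    {ℓ : Type*} [LieRing ℓ] [LieAlgebra K ℓ] [FiniteDimensional K ℓ]
    [LieAlgebra.IsSemisimple K ℓ] [Nontrivial ℓ]
    {ι : Type*} [Fintype ι] (e : Module.Basis ι K ℓ) :
    (VOWA.rState e ∈ VOWA.invariants e ∧
      VOWA.RepresentsNontrivialClass (VOWA.Q e) (VOWA.rState e)) ∧
    (VOWA.tState e ∈ VOWA.invariants e ∧
      VOWA.RepresentsNontrivialClass (VOWA.Q e) (VOWA.tState e)) :=
  ⟨⟨VOWA.rState_mem_invariants e, VOWA.rState_representsNontrivialClass e⟩,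
    VOWA.tState_mem_invariants e, VOWA.tState_representsNontrivialClass e⟩
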